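/- **Setting.** Let $\mu^*$ be a probability measure on a measurable space $\mathcal Z$, let $g:\mathcal Z\to\mathbb R^k$ be measurable and square-integrable under $\mu^*$, and put $m_0=\mathbb E_{\mu^*}g$, $\Sigma=\mathbb E_{\mu^*}[(g-m_0)(g-m_0)']$. Let $d\le k$, let $\Theta\subseteq\mathbb R^d$, and for each $\theta$ let $\mathcal M_\theta$ be a set of probability measures on $\mathcal Z$ such that $g$ is integrable under every $\mu\in\mathcal M_\theta$, $\theta\in\Theta$. Put $M_\theta=\{\mathbb E_\mu g:\mu\in\mathcal M_\theta\}$. Let $Z_1,Z_2,\dots$ be observations in $\mathcal Z$, $\mathbb E_n g=\frac1n\sum_{i\le n}g(Z_i)$, let $\Sigma_n$ be random $k\times k$ matrices, and define (with infimum over the empty set equal to $+\infty$) $$W(\theta)=\inf_{\mu\in\mathcal M_\theta}(m_0-\mathbb E_\mu g)'\Sigma^{-1}(m_0-\mathbb E_\mu g),\qquad W_n(\theta)=\inf_{\mu\in\mathcal M_\theta}(\mathbb E_n g-\mathbb E_\mu g)'\Sigma_n^{-1}(\mathbb E_n g-\mathbb E_\mu g).$$ **Assumptions.** $\sqrt n(\mathbb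 E_n g-m_0)\Rightarrow N(0,\Sigma)$ with $\Sigma$ nonsingular, $\Sigma_n\to\Sigma$ in probability, and: 1. $W$ is lower semicontinuous on $\Theta$, and $\theta_0\in\Theta$ is the unique solution in $\Theta$ of $W(\theta)=0$. 2. $\Theta$ is compact, and $\Theta\cap U$ is convex for some neighborhood $U$ of $\theta_0$. 3. For a closed convex cone $K\subseteq\mathbb R^k$, a matrix $\gamma\in\mathbb R^{k\times d}$ of rank $d$ and a convex cone $C\subseteq\mathbb R^d$, - $\inf_{c\in K}\|m-m_0-\gamma(\theta-\theta_0)-c\|=o(\|\theta-\theta_0\|+\|m-m_0\|)$ uniformly over $\theta\in\Theta$, $m\in M_\theta$; - $\inf_{m\in M_\theta}\|m-m_0-\gamma(\theta-\theta_0)-c\|=o(\|\theta-\theta_0\|+\|c\|)$ uniformly over $\theta\in\Theta$, $c\in K$; - $\inf_{c\in C}\|\theta-\theta_0-c\|=o(\|\theta-\theta_0\|)$ uniformly over $\theta\in\Theta$, and $\inf_{\theta\in\Theta}\|\theta-\theta_0-c\|=o(\|c\|)$ uniformly over $c\in C$. 4. $\gamma(C-C)\cap(K-K)=\{0\}$.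 Let $\hat\theta_n$ be $\Theta$-valued estimators with $W_n(\hat\theta_n)\le\inf_{\theta\in\Theta}W_n(\theta)+o_p(n^{-1})$. **(a)** Let $A$ be a $d\times\ell$ matrix with linearly independent columns and $\mathrm{im}(A)=C-C$, and let $B$ be a $k\times(k-\ell)$ matrix of full rank with $K-K\subseteq\mathrm{im}(B)$ and $\mathrm{im}(B)\cap\mathrm{im}(\gamma A)=\{0\}$. Then the $k\times k$ matrix $R=(\gamma A,B)$ is invertible and $$\sqrt n(\hat\theta_n-\theta_0)\Rightarrow A\big[R^{-1}\Sigma^{1/2}\,\Pi_{\Sigma^{-1/2}(\gamma(C)+K)}\mathbb Z\big]_\ell,\qquad \mathbb Z\sim N(0,I_k),$$ where $[v]_\ell$ is the vector of the first $\ell$ coordinates of $v$ and $\Pi_S$ is the Euclidean metric projection onto the closure of the convex set $S$ (for closed $C$ the set $\Sigma^{-1/2}(\gamma(C)+K)$ is itself closed). **(b)** Suppose moreover that $C=\mathbb R^d$ and that $K$ is a $p$-dimensional subspace, spanned by the columns of a $k\times p$ matrix $B$. Put $S_\theta=\gamma'\Sigma^{-1}(g-m_0)$, $S_K=B'\Sigma^{-1}(g-m_0)$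 and $L=\mathbb E_{\mu^*}[S_\theta S_K']\,\mathbb E_{\mu^*}[S_KS_K']^{-1}$. Then $\mathbb E_{\mu^*}[S_KS_K']$ and $\mathbb E_{\mu^*}[(S_\theta-LS_K)(S_\theta-LS_K)']$ are invertible and $$\sqrt n(\hat\theta_n-\theta_0)\Rightarrow N\big(0,\ \mathbb E_{\mu^*}[(S_\theta-LS_K)(S_\theta-LS_K)']^{-1}\big).$$ -/

import Mathlib

open MeasureTheory ProbabilityTheory Filter Topology Matrix
open scoped Pointwise MatrixOrder ENNReal

namespace PointIdEstimation

noncomputable section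

variable {d k : ℕ} {Ω 𝒵 : Type*} [MeasurableSpace Ω] [MeasurableSpace 𝒵]

/-- Euclidean space `ℝ^n` with the Euclidean norm. -/
abbrev Vec (n : ℕ) : Type := EuclideanSpace ℝ (Fin n)

/-- The quadratic form `x ↦ x' S⁻¹ x`. -/
def invQuad (S : Matrix (Fin k) (Fin k) ℝ) (x : Vec k) : ℝ :=
  x.ofLp ⬝ᵥ (S⁻¹ *ᵥ x.ofLp)

/-- The moment vector `E_μ g`. -/
def moment (g : 𝒵 → Vec k) (μ : ProbabilityMeasure 𝒵) : Vec k :=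
  ∫ z, g z ∂(μ : Measure 𝒵)

/-- The moment set `M = {E_μ g : μ ∈ 𝓜}`. -/
def momentSet (g : 𝒵 → Vec k) (𝓜 : Set (ProbabilityMeasure 𝒵)) : Set (Vec k) :=
  {m | ∃ μ ∈ 𝓜, moment g μ = m}

/-- The covariance matrix `E_μ[(g - E_μ g)(g - E_μ g)']`. -/
def momentCov (g : 𝒵 → Vec k) (μ : ProbabilityMeasure 𝒵) : Matrix (Fin k) (Fin k) ℝ :=
  Matrix.of fun i j => ∫ z, (g z i - moment g μ i) * (g z j - moment g μ j) ∂(μ : Measure 𝒵)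

/-- The criterion `inf_{μ ∈ 𝓜} (a - E_μ g)' S⁻¹ (a - E_μ g)`, an extended real
(equal to `+∞` when `𝓜` is empty). With `a = E_{μ*} g`, `S = Σ` this is `W(θ)`, and with
`a = E_n g`, `S = Σ_n` it is `W_n(θ)`. -/
def criterion (g : 𝒵 → Vec k) (𝓜 : Set (ProbabilityMeasure 𝒵))
    (S : Matrix (Fin k) (Fin k) ℝ) (a : Vec k) : EReal :=
  ⨅ μ ∈ 𝓜, ((invQuad S (a - moment g μ) : ℝ) : EReal)

/-- The sample expectation `E_n g` of the first `n` observations. -/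
def sampleMean (g : 𝒵 → Vec k) (Z : ℕ → Ω → 𝒵) (n : ℕ) (ω : Ω) : Vec k :=
  (n : ℝ)⁻¹ • ∑ i ∈ Finset.range n, g (Z i ω)

/-- `θhat n` is an estimator with values in `Θ` and
`W_n(θhat n) ≤ inf_{θ ∈ Θ} W_n(θ) + o_p(n⁻¹)`: for every `ε > 0`, the probability that the
excess is larger than `ε / n` tends to zero. -/
structure IsApproxMinimizer (P : Measure Ω) (Z : ℕ → Ω → 𝒵) (g : 𝒵 → Vec k)
    (𝓜 : Vec d → Set (ProbabilityMeasure 𝒵)) (Θ : Set (Vec d))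
    (Sn : ℕ → Ω → Matrix (Fin k) (Fin k) ℝ) (θhat : ℕ → Ω → Vec d) : Prop where
  aemeasurable : ∀ n, AEMeasurable (θhat n) P
  mem : ∀ n, ∀ᵐ ω ∂P, θhat n ω ∈ Θ
  approx : ∀ ε : ℝ, 0 < ε → Tendsto
    (fun n : ℕ => P {ω |
      (⨅ θ ∈ Θ, criterion g (𝓜 θ) (Sn n ω) (sampleMean g Z n ω)) + ((ε / n : ℝ) : EReal)
        < criterion g (𝓜 (θhat n ω)) (Sn n ω) (sampleMean g Z n ω)}) atTop (𝓝 0)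

/-- Chernoff regularity of the moment sets `M θ` at `m0`, with derivative `γ` and cone `K`.
The infimum of a distance over a set is `Metric.infEDist`, which is `∞` for the empty set. -/
structure ChernoffMoments (M : Vec d → Set (Vec k)) (Θ : Set (Vec d)) (θ0 : Vec d) (m0 : Vec k)
    (γ : Matrix (Fin k) (Fin d) ℝ) (K : Set (Vec k)) : Prop where
  approx_cone : ∀ ε : ℝ, 0 < ε → ∃ δ : ℝ, 0 < δ ∧ ∀ θ ∈ Θ, ∀ m ∈ M θ,
    ‖θ - θ0‖ + ‖m - m0‖ < δ →
      Metric.infEDist (m - m0 - γ.toEuclideanLin (θ - θ0)) K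
        ≤ ENNReal.ofReal (ε * (‖θ - θ0‖ + ‖m - m0‖))
  approx_set : ∀ ε : ℝ, 0 < ε → ∃ δ : ℝ, 0 < δ ∧ ∀ θ ∈ Θ, ∀ c ∈ K,
    ‖θ - θ0‖ + ‖c‖ < δ →
      Metric.infEDist (m0 + γ.toEuclideanLin (θ - θ0) + c) (M θ)
        ≤ ENNReal.ofReal (ε * (‖θ - θ0‖ + ‖c‖))

/-- Chernoff regularity of `Θ` at `θ0`, with approximating cone `C`. -/
structure ChernoffParam (Θ : Set (Vec d)) (θ0 : Vec d) (C : Set (Vec d)) : Prop where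
  approx_cone : ∀ ε : ℝ, 0 < ε → ∃ δ : ℝ, 0 < δ ∧ ∀ θ ∈ Θ, ‖θ - θ0‖ < δ →
    Metric.infEDist (θ - θ0) C ≤ ENNReal.ofReal (ε * ‖θ - θ0‖)
  approx_set : ∀ ε : ℝ, 0 < ε → ∃ δ : ℝ, 0 < δ ∧ ∀ c ∈ C, ‖c‖ < δ →
    Metric.infEDist (θ0 + c) Θ ≤ ENNReal.ofReal (ε * ‖c‖)

/-- The assumptions for estimation under point identification. -/
structure Assumptions (P : Measure Ω) [IsProbabilityMeasure P] (Z : ℕ → Ω → 𝒵)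
    (g : 𝒵 → Vec k) (μs : ProbabilityMeasure 𝒵) (𝓜 : Vec d → Set (ProbabilityMeasure 𝒵))
    (Θ : Set (Vec d)) (θ0 : Vec d) (Sn : ℕ → Ω → Matrix (Fin k) (Fin k) ℝ)
    (γ : Matrix (Fin k) (Fin d) ℝ) (K : ConvexCone ℝ (Vec k)) (C : ConvexCone ℝ (Vec d)) :
    Prop where
  measurable_obs : ∀ i, Measurable (Z i)
  measurable_g : Measurable g
  memLp_g : MemLp g 2 (μs : Measure 𝒵)
  integrable_g : ∀ θ ∈ Θ, ∀ μ ∈ 𝓜 θ, Integrable g (μ : Measure 𝒵)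
  /-- `√n (E_n g - E_{μ*} g)` converges in law to `N(0, Σ)`. -/
  clt : TendstoInDistribution
    (fun (n : ℕ) ω => Real.sqrt n • (sampleMean g Z n ω - moment g μs)) atTop id (fun _ => P)
    (multivariateGaussian 0 (momentCov g μs))
  nonsingular : IsUnit (momentCov g μs).det
  consistent : ∀ i j, TendstoInMeasure P (fun n ω => Sn n ω i j) atTop
    (fun _ => momentCov g μs i j)
  lsc : LowerSemicontinuousOn
    (fun θ => criterion g (𝓜 θ) (momentCov g μs) (moment g μs)) Θ
  mem_param : θ0 ∈ Θ
  solves : criterion g (𝓜 θ0) (momentCov g μs) (moment g μs) = 0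
  unique : ∀ θ ∈ Θ, criterion g (𝓜 θ) (momentCov g μs) (moment g μs) = 0 → θ = θ0
  dim_le : d ≤ k
  compact_param : IsCompact Θ
  locally_convex : ∃ U ∈ 𝓝 θ0, Convex ℝ (Θ ∩ U)
  closed_K : IsClosed (K : Set (Vec k))
  full_rank : γ.rank = d
  chernoff_moments :
    ChernoffMoments (fun θ => momentSet g (𝓜 θ)) Θ θ0 (moment g μs) γ K
  chernoff_param : ChernoffParam Θ θ0 C
  transversal : (γ.toEuclideanLin '' ((C : Set (Vec d)) - (C : Set (Vec d)))) ∩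
    ((K : Set (Vec k)) - (K : Set (Vec k))) = {0}

/-- Metric projection onto (the closure of) a nonempty convex set `S`: the point of the closure
of `S` that is nearest to `z`. -/
def metricProj (S : Set (Vec k)) (z : Vec k) : Vec k :=
  Classical.epsilon fun p => p ∈ closure S ∧ ∀ s ∈ S, ‖z - p‖ ≤ ‖z - s‖

/-- The metric projection onto a nonempty convex set is the unique nearest point. -/
theorem metricProj_spec {S : Set (Vec k)} (hne : S.Nonempty) (hconv : Convex ℝ S) (z p : Vec k) :
    metricProj S z = p ↔ p ∈ closure S ∧ ∀ s ∈ S, ‖z - p‖ ≤ ‖z - s‖ := by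
  have key : ∀ p : Vec k, p ∈ closure S → ((∀ s ∈ S, ‖z - p‖ ≤ ‖z - s‖) ↔
      ∀ s ∈ closure S, inner ℝ (z - p) (s - p) ≤ 0) := by
    intro p hp
    have hne' : (closure S).Nonempty := hne.closure
    rw [← norm_eq_iInf_iff_real_inner_le_zero hconv.closure hp]
    have : Nonempty (closure S) := hne'.to_subtype
    have hb : BddBelow (Set.range fun w : closure S => ‖z - w‖) :=
      ⟨0, by rintro _ ⟨w, rfl⟩; exact norm_nonneg _⟩
    constructor
    · intro h
      refine le_antisymm (le_ciInf fun w => ?_) (ciInf_le hb ⟨p, hp⟩)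
      have hc : IsClosed {s : Vec k | ‖z - p‖ ≤ ‖z - s‖} :=
        isClosed_le continuous_const (by fun_prop)
      exact closure_minimal (fun s hs => h s hs) hc w.2
    · intro h s hs
      rw [h]
      exact ciInf_le hb ⟨s, subset_closure hs⟩
  have hex : ∃ p, p ∈ closure S ∧ ∀ s ∈ S, ‖z - p‖ ≤ ‖z - s‖ := by
    obtain ⟨p, hp, h⟩ := exists_norm_eq_iInf_of_complete_convex hne.closure
      isClosed_closure.isComplete hconv.closure z
    exact ⟨p, hp, (key p hp).2 ((norm_eq_iInf_iff_real_inner_le_zero hconv.closure hp).1 h)⟩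
  have hspec := Classical.epsilon_spec hex
  constructor
  · rintro rfl
    exact hspec
  · rintro ⟨hp, h⟩
    have h1 := (key p hp).1 h _ hspec.1
    have h2 := (key _ hspec.1).1 hspec.2 _ hp
    have h3 : ‖metricProj S z - p‖ ^ 2 ≤ 0 := by
      have e : inner ℝ (z - p) (metricProj S z - p) + inner ℝ (z - metricProj S z)
          (p - metricProj S z) = ‖metricProj S z - p‖ ^ 2 := by
        rw [← real_inner_self_eq_norm_sq, ← neg_sub (metricProj S z) p, inner_neg_right,
          ← sub_eq_add_neg, ← inner_sub_left]
        congr 1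
        abel
      rw [← e]
      exact add_nonpos h1 h2
    have h4 : ‖metricProj S z - p‖ = 0 := by
      nlinarith [norm_nonneg (metricProj S z - p)]
    exact sub_eq_zero.1 (norm_eq_zero.1 h4)

/-- The first `l` and the last `k - l` of `k` coordinates. -/
def splitCoords {l k : ℕ} (h : l ≤ k) : Fin l ⊕ Fin (k - l) ≃ Fin k :=
  finSumFinEquiv.trans (finCongr (Nat.add_sub_cancel' h))

/-- The `k × k` block matrix `(D, B)`. -/
def blockMatrix {l k : ℕ} (h : l ≤ k) (D : Matrix (Fin k) (Fin l) ℝ)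
    (B : Matrix (Fin k) (Fin (k - l)) ℝ) : Matrix (Fin k) (Fin k) ℝ :=
  (Matrix.fromCols D B).submatrix id (splitCoords h).symm

/-- The first `l` coordinates of a vector. -/
def firstCoords {l k : ℕ} (h : l ≤ k) (v : Vec k) : Vec l :=
  WithLp.toLp 2 fun i => v (splitCoords h (Sum.inl i))

/-- The set `Σ^{-1/2} (γ C + K)`. -/
def scaledCone (S : Matrix (Fin k) (Fin k) ℝ) (γ : Matrix (Fin k) (Fin d) ℝ)
    (C : Set (Vec d)) (K : Set (Vec k)) : Set (Vec k) :=
  ((CFC.sqrt S)⁻¹).toEuclideanLin '' (γ.toEuclideanLin '' C + K)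

/-- The matrix `E_μ[s t']` for vector-valued functions `s`, `t`. -/
def crossMoment {p q : ℕ} (μ : ProbabilityMeasure 𝒵) (s : 𝒵 → Vec p) (t : 𝒵 → Vec q) :
    Matrix (Fin p) (Fin q) ℝ :=
  Matrix.of fun i j => ∫ z, s z i * t z j ∂(μ : Measure 𝒵)

/-- The function `D' Σ⁻¹ (g - E_μ g)`, where `Σ` is the covariance matrix of `g`. -/
def scoreFn {p : ℕ} (g : 𝒵 → Vec k) (μ : ProbabilityMeasure 𝒵) (D : Matrix (Fin k) (Fin p) ℝ)
    (z : 𝒵) : Vec p :=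
  (Dᵀ * (momentCov g μ)⁻¹).toEuclideanLin (g z - moment g μ)

/-- The matrix `L = E[s t'] E[t t']⁻¹`. -/
def projCoef {p q : ℕ} (μ : ProbabilityMeasure 𝒵) (s : 𝒵 → Vec p) (t : 𝒵 → Vec q) :
    Matrix (Fin p) (Fin q) ℝ :=
  crossMoment μ s t * (crossMoment μ t t)⁻¹

/-- The residual `s - L t`. -/
def residual {p q : ℕ} (μ : ProbabilityMeasure 𝒵) (s : 𝒵 → Vec p) (t : 𝒵 → Vec q) (z : 𝒵) :
    Vec p :=
  s z - (projCoef μ s t).toEuclideanLin (t z)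

/-- The matrix `E[(s - L t)(s - L t)']`. -/
def residualMoment {p q : ℕ} (μ : ProbabilityMeasure 𝒵) (s : 𝒵 → Vec p) (t : 𝒵 → Vec q) :
    Matrix (Fin p) (Fin p) ℝ :=
  crossMoment μ (residual μ s t) (residual μ s t)

end

end PointIdEstimation

/-!
The estimator is analysed along deterministic sequences, and probability enters only at the end.

Fix sequences `r j → ∞` (the scale `√n`), `G j → G` (scaled deviations of the sample mean), weight
matrices converging to `Σ`, and near minimizers `t j ∈ Θ` of the criterion, each with a moment
vector `m j ∈ M (t j)` that nearly attains the criterion. Comparison with moments realizing a fixed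
direction `γ a + c` of the tangent cone (`exists_moments_tendsto_of_chernoff`) bounds
`r j (m j - m0)`. Lower semicontinuity and compactness then force `t j → θ0`, and the cone
approximations write `r j (m j - m0)` as `γ (a j) + c j` up to `o(1)`, with `a j ∈ C`, `c j ∈ K`,
and `r j (t j - θ0) = a j + o(1)`. A linear map `L` with `L (γ a + c) = a`, which exists by
transversality, gives both the rate of `t j - θ0` and the value of `a j`. Every cluster point of
`γ (a j) + c j` is nearest to `G` in the closure of `γ C + K` for the norm `‖Σ^{-1/2} ·‖`, so it is
the unique such point `coneProj G`. Thus `r j (t j - θ0) → L (coneProj G)`, which is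
`tendsto_smul_sub_of_near_minimizer`.

By contradiction and passage to subsequences this holds uniformly over bounded `G`
(`Assumptions.uniform_expansion`). As the scaled sample mean `G_n` is bounded in probability,
`√n (θhat - θ0) - L (coneProj G_n)` tends to `0` in probability, and the continuous mapping theorem
applies because metric projections are nonexpansive (`Assumptions.tendstoInDistribution`).

The two limit laws are two choices of `L`. For a cone, `L` is `A [R⁻¹ ·]_l`, and `G` is `Σ^{1/2}`
applied to a standard normal vector. For a subspace `γ C + K`, `L` is the `Σ⁻¹`-weighted least
squares coefficient of `γ` after partialling out `B`; it annihilates `G - coneProj G`, so the limit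
is a linear image of a Gaussian vector, with covariance the inverse residual second moment.
-/

namespace PointIdEstimation

variable {d k : ℕ} {Ω 𝒵 : Type*} [MeasurableSpace Ω] [MeasurableSpace 𝒵]

/-! ### Near minimizers along a deterministic sequence -/

/-- Points of `S j` whose distance to `x j` is `o(b j)`, up to a term negligible after scaling
by `r j`. -/
lemma exists_mem_dist_le_of_infEDist {E : Type*} [SeminormedAddCommGroup E] [Inhabited E]
    {x : ℕ → E} {S : ℕ → Set E} {b r : ℕ → ℝ} (hb : ∀ j, 0 ≤ b j) (hr : ∀ j, 0 < r j)
    (h : ∀ ε : ℝ, 0 < ε → ∀ᶠ j in atTop, Metric.infEDist (x j) (S j) ≤ ENNReal.ofReal (ε * b j)) :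
    ∃ s : ℕ → E, (∀ᶠ j in atTop, s j ∈ S j) ∧
      ∀ ε : ℝ, 0 < ε → ∀ᶠ j in atTop, r j * ‖x j - s j‖ ≤ ε * (r j * b j + 1) := by
  -- the infimum need not be attained; the slack `1 / (r j * (j + 1))` vanishes after scaling
  have key : ∀ j, ∃ s : E, Metric.infEDist (x j) (S j) < ∞ → s ∈ S j ∧
      ‖x j - s‖ < (Metric.infEDist (x j) (S j)).toReal + 1 / (r j * (j + 1)) := by
    intro j
    by_cases hfin : Metric.infEDist (x j) (S j) < ∞
    · have hpos : 0 < 1 / (r j * (j + 1)) := by have := hr j; positivity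
      have hlt : Metric.infEDist (x j) (S j) <
          ENNReal.ofReal ((Metric.infEDist (x j) (S j)).toReal + 1 / (r j * (j + 1))) := by
        rw [← ENNReal.toReal_lt_toReal hfin.ne ENNReal.ofReal_ne_top,
          ENNReal.toReal_ofReal (by positivity)]
        linarith
      obtain ⟨s, hs, hd⟩ := Metric.infEDist_lt_iff.1 hlt
      refine ⟨s, fun _ => ⟨hs, ?_⟩⟩
      rw [edist_dist, dist_eq_norm] at hd
      exact (ENNReal.ofReal_lt_ofReal_iff_of_nonneg (norm_nonneg _)).1 hd
    · exact ⟨default, fun h => absurd h hfin⟩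
  choose s hs using key
  refine ⟨s, ?_, fun ε hε => ?_⟩
  · filter_upwards [h 1 one_pos] with j hj
    exact (hs j (hj.trans_lt ENNReal.ofReal_lt_top)).1
  · have hN : ∀ᶠ j : ℕ in atTop, 1 / ((j : ℝ) + 1) < ε :=
      (tendsto_one_div_add_atTop_nhds_zero_nat (𝕜 := ℝ)).eventually_lt_const hε
    filter_upwards [h ε hε, hN] with j hj hjN
    have h1 := (hs j (hj.trans_lt ENNReal.ofReal_lt_top)).2
    have h2 : (Metric.infEDist (x j) (S j)).toReal ≤ ε * b j :=
      ENNReal.toReal_le_of_le_ofReal (mul_nonneg hε.le (hb j)) hj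
    have h3 : r j * ‖x j - s j‖ ≤ r j * (ε * b j + 1 / (r j * (j + 1))) :=
      mul_le_mul_of_nonneg_left (by linarith) (hr j).le
    have h4 : r j * (1 / (r j * (j + 1))) = 1 / ((j : ℝ) + 1) := by
      have := (hr j).ne'
      field_simp
    nlinarith

/-- If the bounds `b j` are of order `1 / r j`, errors of order `o(b j)` vanish after scaling. -/
lemma tendsto_smul_zero_of_mul_norm_le {E : Type*} [SeminormedAddCommGroup E] [NormedSpace ℝ E]
    {y : ℕ → E} {b r : ℕ → ℝ} (hr : ∀ j, 0 < r j) {R : ℝ} (hR : ∀ᶠ j in atTop, r j * b j ≤ R)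
    (h : ∀ ε : ℝ, 0 < ε → ∀ᶠ j in atTop, r j * ‖y j‖ ≤ ε * (r j * b j + 1)) :
    Tendsto (fun j => r j • y j) atTop (𝓝 0) := by
  rw [tendsto_zero_iff_norm_tendsto_zero, Metric.tendsto_nhds]
  intro ε hε
  have hpos : 0 < |R| + 2 := by positivity
  filter_upwards [hR, h (ε / (|R| + 2)) (by positivity)] with j h1 h2
  rw [Real.dist_eq, sub_zero, abs_norm, norm_smul, Real.norm_of_nonneg (hr j).le]
  calc r j * ‖y j‖ ≤ ε / (|R| + 2) * (r j * b j + 1) := h2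
    _ ≤ ε / (|R| + 2) * (|R| + 1) :=
        mul_le_mul_of_nonneg_left (by linarith [le_abs_self R]) (by positivity)
    _ < ε := by
        rw [div_mul_eq_mul_div, div_lt_iff₀ hpos]
        nlinarith

/-- A sequence of order `1 / r j` with `r j → ∞` tends to zero. -/
lemma tendsto_of_mul_norm_le {E : Type*} [SeminormedAddCommGroup E]
    {y : ℕ → E} {r : ℕ → ℝ} (hr : Tendsto r atTop atTop) {R : ℝ}
    (hR : ∀ᶠ j in atTop, r j * ‖y j‖ ≤ R) : Tendsto y atTop (𝓝 0) := by
  rw [tendsto_zero_iff_norm_tendsto_zero]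
  refine squeeze_zero' (.of_forall fun _ => norm_nonneg _) ?_ (hr.const_div_atTop R)
  filter_upwards [hR, hr.eventually_gt_atTop 0] with j h1 h2
  rw [le_div_iff₀ h2]
  linarith

/-- Every direction `γ a + c` of the tangent cone is attained, to first order, by moments of
parameters in `Θ`. -/
lemma exists_moments_tendsto_of_chernoff {M : Vec d → Set (Vec k)} {Θ : Set (Vec d)}
    {θ0 : Vec d} {m0 : Vec k} {γ : Matrix (Fin k) (Fin d) ℝ} {K : ConvexCone ℝ (Vec k)}
    {C : ConvexCone ℝ (Vec d)} (hM : ChernoffMoments M Θ θ0 m0 γ K) (hΘ : ChernoffParam Θ θ0 C)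
    {r : ℕ → ℝ} (hr : ∀ j, 0 < r j) (hrt : Tendsto r atTop atTop)
    {a : Vec d} (ha : a ∈ C) {c : Vec k} (hc : c ∈ K) :
    ∃ (t : ℕ → Vec d) (m : ℕ → Vec k), (∀ᶠ j in atTop, t j ∈ Θ ∧ m j ∈ M (t j)) ∧
      Tendsto (fun j => r j • (m j - m0)) atTop (𝓝 (γ.toEuclideanLin a + c)) := by
  have hinv : Tendsto (fun j => (r j)⁻¹) atTop (𝓝 0) := hrt.inv_tendsto_atTop
  have hsm : ∀ {n : ℕ} (v : Vec n), Tendsto (fun j => ‖(r j)⁻¹ • v‖) atTop (𝓝 0) := by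
    intro n v
    have := (hinv.smul_const v).norm
    simpa using this
  have hrn : ∀ {n : ℕ} (v : Vec n) j, r j * ‖(r j)⁻¹ • v‖ = ‖v‖ := by
    intro n v j
    rw [norm_smul, norm_inv, Real.norm_of_nonneg (hr j).le, mul_inv_cancel_left₀ (hr j).ne']
  -- parameters close to `θ0 + a / r`
  obtain ⟨t, htΘ, ht⟩ := exists_mem_dist_le_of_infEDist (x := fun j => θ0 + (r j)⁻¹ • a)
    (S := fun _ => Θ) (b := fun j => ‖(r j)⁻¹ • a‖) (fun _ => norm_nonneg _) hr (by
      intro ε hε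
      obtain ⟨δ, hδ, H⟩ := hΘ.approx_set ε hε
      filter_upwards [(hsm a).eventually_lt_const hδ] with j hj
      exact H _ (C.smul_mem (inv_pos.2 (hr j)) ha) hj)
  have ht0 := tendsto_smul_zero_of_mul_norm_le hr (R := ‖a‖)
    (.of_forall fun j => (hrn a j).le) ht
  have hta : Tendsto (fun j => r j • (t j - θ0)) atTop (𝓝 a) := by
    have := ht0.const_sub a
    rw [sub_zero] at this
    refine this.congr fun j => ?_
    have h1 := smul_inv_smul₀ (hr j).ne' a
    rw [smul_sub, smul_add, h1, smul_sub]
    abel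
  have htR : ∀ᶠ j in atTop, r j * ‖t j - θ0‖ ≤ ‖a‖ + 1 := by
    filter_upwards [hta.norm.eventually_lt_const (lt_add_one _)] with j hj
    rw [norm_smul, Real.norm_of_nonneg (hr j).le] at hj
    exact hj.le
  have htn : Tendsto (fun j => ‖t j - θ0‖) atTop (𝓝 0) := by
    simpa using (tendsto_of_mul_norm_le hrt htR).norm
  -- moments close to `m0 + γ (t - θ0) + c / r`
  obtain ⟨m, hm, hmd⟩ := exists_mem_dist_le_of_infEDist
    (x := fun j => m0 + γ.toEuclideanLin (t j - θ0) + (r j)⁻¹ • c)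
    (S := fun j => M (t j)) (b := fun j => ‖t j - θ0‖ + ‖(r j)⁻¹ • c‖)
    (fun _ => by positivity) hr (by
      intro ε hε
      obtain ⟨δ, hδ, H⟩ := hM.approx_set ε hε
      have hs := htn.add (hsm c)
      rw [add_zero] at hs
      filter_upwards [hs.eventually_lt_const hδ, htΘ] with j hj hjΘ
      exact H _ hjΘ _ (K.smul_mem (inv_pos.2 (hr j)) hc) hj)
  have hm0 := tendsto_smul_zero_of_mul_norm_le hr (R := ‖a‖ + 1 + ‖c‖) (by
    filter_upwards [htR] with j hj
    rw [mul_add, hrn]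
    linarith) hmd
  refine ⟨t, m, htΘ.and hm, ?_⟩
  have hγ : Tendsto (fun j => γ.toEuclideanLin (r j • (t j - θ0))) atTop
      (𝓝 (γ.toEuclideanLin a)) :=
    ((LinearMap.continuous_of_finiteDimensional γ.toEuclideanLin).tendsto a).comp hta
  have := (hγ.add_const c).sub hm0
  rw [sub_zero] at this
  refine this.congr fun j => ?_
  have h1 := smul_inv_smul₀ (hr j).ne' c
  simp only [map_smul, map_sub, smul_sub, smul_add, h1]
  abel

/-- Quadratic forms `q j` that converge to `‖T ·‖²` uniformly on bounded sets converge along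
convergent sequences. -/
lemma tendsto_quad_sub_zero {E F : Type*} [NormedAddCommGroup E] [NormedSpace ℝ E]
    [NormedAddCommGroup F] [NormedSpace ℝ F] {T : E →L[ℝ] F} {q : ℕ → E → ℝ} {ε : ℕ → ℝ}
    (hε : Tendsto ε atTop (𝓝 0)) (hq : ∀ᶠ j in atTop, ∀ x, |q j x - ‖T x‖ ^ 2| ≤ ε j * ‖x‖ ^ 2)
    {x y : ℕ → E} {R : ℝ} (hR : ∀ᶠ j in atTop, ‖x j‖ ≤ R)
    (hxy : Tendsto (fun j => x j - y j) atTop (𝓝 0)) :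
    Tendsto (fun j => q j (x j) - ‖T (y j)‖ ^ 2) atTop (𝓝 0) := by
  have h1 : Tendsto (fun j => q j (x j) - ‖T (x j)‖ ^ 2) atTop (𝓝 0) := by
    have hb : Tendsto (fun j => |ε j| * R ^ 2) atTop (𝓝 0) := by
      simpa using hε.abs.mul_const (R ^ 2)
    refine squeeze_zero_norm' ?_ hb
    filter_upwards [hq, hR] with j hj hjR
    refine (hj _).trans ?_
    have : ‖x j‖ ^ 2 ≤ R ^ 2 := pow_le_pow_left₀ (norm_nonneg _) hjR 2
    exact mul_le_mul (le_abs_self _) this (by positivity) (abs_nonneg _)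
  have h2 : Tendsto (fun j => ‖T (x j)‖ ^ 2 - ‖T (y j)‖ ^ 2) atTop (𝓝 0) := by
    have hz := (hxy.norm.const_mul ‖T‖)
    have hb := hz.mul (hz.const_add (‖T‖ * R + ‖T‖ * R))
    rw [norm_zero, mul_zero, zero_mul] at hb
    refine squeeze_zero_norm' ?_ hb
    filter_upwards [hR] with j hj
    have e1 : |‖T (x j)‖ - ‖T (y j)‖| ≤ ‖T‖ * ‖x j - y j‖ := by
      refine (abs_norm_sub_norm_le _ _).trans ?_
      rw [← map_sub]
      exact T.le_opNorm _
    have e2 : ‖T (x j)‖ ≤ ‖T‖ * R :=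
      (T.le_opNorm _).trans (mul_le_mul_of_nonneg_left hj (norm_nonneg _))
    have e3 := (abs_le.1 e1).1
    rw [Real.norm_eq_abs, sq_sub_sq, abs_mul, mul_comm]
    refine mul_le_mul e1 ?_ (abs_nonneg _) (by positivity)
    rw [abs_of_nonneg (by positivity)]
    linarith
  simpa using h1.add h2

/-- **Deterministic limit of near minimizers.** Let `T` define the limiting norm, and let
`(t j, m j)` minimize `q j (G j - r j (m - m0))` over `t ∈ Θ`, `m ∈ M t` up to `η j → 0`.
The map `L` reads off `a` from `γ a + c`. If `p` is the only point of the closure of `γ C + K`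
that is nearest to `lim G j` in the norm `‖T ·‖`, then `r j (t j - θ0) → L p`. -/
theorem tendsto_smul_sub_of_near_minimizer {F : Type*} [NormedAddCommGroup F] [NormedSpace ℝ F]
    {M : Vec d → Set (Vec k)} {Θ : Set (Vec d)}
    {θ0 : Vec d} {m0 : Vec k} {γ : Matrix (Fin k) (Fin d) ℝ} {K : ConvexCone ℝ (Vec k)}
    {C : ConvexCone ℝ (Vec d)} (hM : ChernoffMoments M Θ θ0 m0 γ K) (hΘ : ChernoffParam Θ θ0 C)
    (hcomp : IsCompact Θ)
    (hsep : ∀ θ ∈ Θ, θ ≠ θ0 → ∃ η : ℝ, 0 < η ∧ ∀ᶠ θ' in 𝓝[Θ] θ, ∀ m ∈ M θ', η ≤ ‖m - m0‖)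
    (hC : (C : Set (Vec d)).Nonempty) (hK : (K : Set (Vec k)).Nonempty)
    (L : Vec k →L[ℝ] Vec d) (hL : ∀ a ∈ C, ∀ c ∈ K, L (γ.toEuclideanLin a + c) = a)
    {T : Vec k →L[ℝ] F} {lam : ℝ} (hlam : 0 < lam) (hT : ∀ x, lam * ‖x‖ ^ 2 ≤ ‖T x‖ ^ 2)
    {r : ℕ → ℝ} (hr : ∀ j, 0 < r j) (hrt : Tendsto r atTop atTop)
    {q : ℕ → Vec k → ℝ} {ε : ℕ → ℝ} (hε : Tendsto ε atTop (𝓝 0))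
    (hq : ∀ᶠ j in atTop, ∀ x, |q j x - ‖T x‖ ^ 2| ≤ ε j * ‖x‖ ^ 2)
    {G : ℕ → Vec k} {G0 : Vec k} (hG : Tendsto G atTop (𝓝 G0))
    {η : ℕ → ℝ} (hη : Tendsto η atTop (𝓝 0)) {t : ℕ → Vec d} {m : ℕ → Vec k}
    (ht : ∀ᶠ j in atTop, t j ∈ Θ) (hm : ∀ᶠ j in atTop, m j ∈ M (t j))
    (hmin : ∀ᶠ j in atTop, ∀ θ ∈ Θ, ∀ m' ∈ M θ,
      q j (G j - r j • (m j - m0)) ≤ q j (G j - r j • (m' - m0)) + η j)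
    {p : Vec k} (hp : ∀ x ∈ closure (γ.toEuclideanLin '' (C : Set (Vec d)) + (K : Set (Vec k))),
      (∀ s ∈ γ.toEuclideanLin '' (C : Set (Vec d)) + (K : Set (Vec k)),
        ‖T (G0 - x)‖ ^ 2 ≤ ‖T (G0 - s)‖ ^ 2) → x = p) :
    Tendsto (fun j => r j • (t j - θ0)) atTop (𝓝 (L p)) := by
  have hγc : Continuous γ.toEuclideanLin :=
    LinearMap.continuous_of_finiteDimensional γ.toEuclideanLin
  -- comparison with the competitors that realize a direction `γ a + c`
  have hcmp : ∀ a ∈ C, ∀ c ∈ K, ∃ f : ℕ → ℝ,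
      Tendsto f atTop (𝓝 (‖T (G0 - (γ.toEuclideanLin a + c))‖ ^ 2)) ∧
      ∀ᶠ j in atTop, q j (G j - r j • (m j - m0)) ≤ f j := by
    intro a ha c hc
    obtain ⟨t', m', hmem, hlim⟩ := exists_moments_tendsto_of_chernoff hM hΘ hr hrt ha hc
    have hd : Tendsto (fun j => G j - r j • (m' j - m0)) atTop
        (𝓝 (G0 - (γ.toEuclideanLin a + c))) := hG.sub hlim
    have hbd : ∀ᶠ j in atTop,
        ‖G j - r j • (m' j - m0)‖ ≤ ‖G0 - (γ.toEuclideanLin a + c)‖ + 1 :=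
      (hd.norm.eventually_lt_const (lt_add_one _)).mono fun _ h => h.le
    have h0 := tendsto_quad_sub_zero hε hq hbd (y := fun _ => G0 - (γ.toEuclideanLin a + c))
      (tendsto_sub_nhds_zero_iff.2 hd)
    refine ⟨fun j => q j (G j - r j • (m' j - m0)) + η j, ?_, ?_⟩
    · have := (tendsto_sub_nhds_zero_iff.1 h0).add hη
      rwa [add_zero] at this
    · filter_upwards [hmin, hmem] with j h1 h2
      exact h1 _ h2.1 _ h2.2
  obtain ⟨a0, ha0⟩ := hC
  obtain ⟨c0, hc0⟩ := hK
  -- the scaled deviations of the moments are bounded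
  obtain ⟨R, hR⟩ : ∃ R : ℝ, ∀ᶠ j in atTop, ‖G j - r j • (m j - m0)‖ ≤ R := by
    obtain ⟨f, hf, hle⟩ := hcmp a0 ha0 c0 hc0
    set b := ‖T (G0 - (γ.toEuclideanLin a0 + c0))‖ ^ 2
    refine ⟨Real.sqrt ((b + 1) / (lam / 2)), ?_⟩
    filter_upwards [hq, hle, hf.eventually_lt_const (lt_add_one b),
      hε.eventually_lt_const (half_pos hlam)] with j h1 h2 h3 h4
    apply Real.le_sqrt_of_sq_le
    rw [le_div_iff₀ (half_pos hlam)]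
    have h5 := (abs_le.1 (h1 (G j - r j • (m j - m0)))).1
    have h6 := hT (G j - r j • (m j - m0))
    nlinarith [sq_nonneg ‖G j - r j • (m j - m0)‖]
  obtain ⟨Ru, hRu⟩ : ∃ R : ℝ, ∀ᶠ j in atTop, r j * ‖m j - m0‖ ≤ R := by
    refine ⟨R + (‖G0‖ + 1), ?_⟩
    filter_upwards [hR, hG.norm.eventually_lt_const (lt_add_one _)] with j h1 h2
    have h3 : r j • (m j - m0) = G j - (G j - r j • (m j - m0)) := by abel
    rw [← Real.norm_of_nonneg (hr j).le, ← norm_smul, h3]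
    refine (norm_sub_le _ _).trans ?_
    linarith
  have hm0 : Tendsto (fun j => ‖m j - m0‖) atTop (𝓝 0) := by
    simpa using (tendsto_of_mul_norm_le hrt hRu).norm
  -- consistency: a cluster point other than `θ0` would keep the moments away from `m0`
  have hcons : Tendsto t atTop (𝓝 θ0) := by
    refine hcomp.tendsto_nhds_of_unique_mapClusterPt ht fun θ hθ hcl => ?_
    by_contra hne
    obtain ⟨e, he, hev⟩ := hsep θ hθ hne
    rw [eventually_nhdsWithin_iff] at hev
    have hfr := hcl.frequently hev
    obtain ⟨j, h1, h2, h3, h4⟩ :=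
      (hfr.and_eventually (ht.and (hm.and (hm0.eventually_lt_const he)))).exists
    exact absurd (h1 h2 _ h3) (not_le.2 h4)
  have ht0 : Tendsto (fun j => ‖t j - θ0‖) atTop (𝓝 0) := by
    simpa using (tendsto_sub_nhds_zero_iff.2 hcons).norm
  -- local cone approximations of the parameters and of the moments
  obtain ⟨a, ha, had⟩ := exists_mem_dist_le_of_infEDist (x := fun j => t j - θ0)
    (S := fun _ => (C : Set (Vec d))) (b := fun j => ‖t j - θ0‖) (fun _ => norm_nonneg _) hr (by
      intro e he
      obtain ⟨δ, hδ, H⟩ := hΘ.approx_cone e he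
      filter_upwards [ht0.eventually_lt_const hδ, ht] with j hj hjΘ
      exact H _ hjΘ hj)
  obtain ⟨c, hc, hcd⟩ := exists_mem_dist_le_of_infEDist
    (x := fun j => m j - m0 - γ.toEuclideanLin (t j - θ0))
    (S := fun _ => (K : Set (Vec k))) (b := fun j => ‖t j - θ0‖ + ‖m j - m0‖)
    (fun _ => by positivity) hr (by
      intro e he
      obtain ⟨δ, hδ, H⟩ := hM.approx_cone e he
      have hs := ht0.add hm0
      rw [add_zero] at hs
      filter_upwards [hs.eventually_lt_const hδ, ht, hm] with j hj hjΘ hjm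
      exact H _ hjΘ _ hjm hj)
  set Γ : Vec d →L[ℝ] Vec k := LinearMap.toContinuousLinearMap γ.toEuclideanLin with hΓ
  have hΓa : ∀ v, γ.toEuclideanLin v = Γ v := fun _ => rfl
  -- the rate of convergence of the parameters
  obtain ⟨Rt, hRt⟩ : ∃ R : ℝ, ∀ᶠ j in atTop, r j * ‖t j - θ0‖ ≤ R := by
    refine ⟨2 * ‖L‖ * Ru + |Ru| + 2, ?_⟩
    -- the approximation errors enter with total weight `D`, absorbed by `ε = 1 / (2 D)`
    set D : ℝ := ‖L‖ + ‖L‖ * ‖Γ‖ + 1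
    have hD : 0 < D := by positivity
    filter_upwards [had (1 / (2 * D)) (by positivity), hcd (1 / (2 * D)) (by positivity), hRu,
      ha, hc] with j h1 h2 h3 h4 h5
    set e := 1 / (2 * D) with hedef
    have heD : e * D = 1 / 2 := by rw [hedef]; field_simp
    have he : 0 < e := by positivity
    have hid : a j = L ((m j - m0) - (m j - m0 - Γ (t j - θ0) - c j) - Γ (t j - θ0 - a j)) := by
      conv_lhs => rw [← hL (a j) h4 (c j) h5, hΓa]
      congr 1
      rw [map_sub Γ (t j - θ0) (a j)]
      abel
    have h6 : ‖a j‖ ≤ ‖L‖ * (‖m j - m0‖ + ‖m j - m0 - Γ (t j - θ0) - c j‖ +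
        ‖Γ‖ * ‖t j - θ0 - a j‖) := by
      conv_lhs => rw [hid]
      refine (L.le_opNorm _).trans (mul_le_mul_of_nonneg_left ?_ (norm_nonneg _))
      refine (norm_sub_le _ _).trans (add_le_add (norm_sub_le _ _) (Γ.le_opNorm _))
    have h7 : ‖t j - θ0‖ ≤ ‖a j‖ + ‖t j - θ0 - a j‖ := by
      have : t j - θ0 = a j + (t j - θ0 - a j) := by abel
      conv_lhs => rw [this]
      exact norm_add_le _ _
    set τ := r j * ‖t j - θ0‖
    set υ := r j * ‖m j - m0‖
    have hυ : 0 ≤ υ := mul_nonneg (hr j).le (norm_nonneg _)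
    have hτ : 0 ≤ τ := mul_nonneg (hr j).le (norm_nonneg _)
    have h8 : τ ≤ ‖L‖ * (υ + r j * ‖m j - m0 - Γ (t j - θ0) - c j‖ +
        ‖Γ‖ * (r j * ‖t j - θ0 - a j‖)) + r j * ‖t j - θ0 - a j‖ := by
      have := mul_le_mul_of_nonneg_left (h7.trans (add_le_add_left h6 _)) (hr j).le
      refine this.trans (le_of_eq ?_)
      ring
    have h2' : r j * ‖m j - m0 - Γ (t j - θ0) - c j‖ ≤ e * (τ + υ + 1) := by
      have : r j * (‖t j - θ0‖ + ‖m j - m0‖) = τ + υ := mul_add _ _ _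
      rw [← this]
      exact h2
    have h1' : r j * ‖t j - θ0 - a j‖ ≤ e * (τ + υ + 1) := by
      refine h1.trans (mul_le_mul_of_nonneg_left (by linarith) he.le)
    have h9 : τ ≤ ‖L‖ * υ + e * D * (τ + υ + 1) := by
      refine h8.trans ?_
      have i1 := mul_le_mul_of_nonneg_left h2' (norm_nonneg L)
      have i2 := mul_le_mul_of_nonneg_left h1' (mul_nonneg (norm_nonneg L) (norm_nonneg Γ))
      simp only [D]
      linarith
    rw [heD] at h9
    have := mul_le_mul_of_nonneg_left h3 (norm_nonneg L)
    linarith [le_abs_self Ru]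
  have hRtu : ∀ᶠ j in atTop, r j * (‖t j - θ0‖ + ‖m j - m0‖) ≤ Rt + Ru := by
    filter_upwards [hRt, hRu] with j h1 h2
    rw [mul_add]
    linarith
  have hta := tendsto_smul_zero_of_mul_norm_le hr hRt had
  have hmc := tendsto_smul_zero_of_mul_norm_le hr hRtu hcd
  -- points of the tangent cone that track the scaled deviations
  set x : ℕ → Vec k := fun j => Γ (r j • a j) + r j • c j with hx
  have hxS : ∀ᶠ j in atTop, x j ∈ γ.toEuclideanLin '' (C : Set (Vec d)) + (K : Set (Vec k)) := by
    filter_upwards [ha, hc] with j h1 h2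
    exact Set.add_mem_add ⟨_, C.smul_mem (hr j) h1, rfl⟩ (K.smul_mem (hr j) h2)
  have hux : Tendsto (fun j => r j • (m j - m0) - x j) atTop (𝓝 0) := by
    have := hmc.add ((Γ.continuous.tendsto 0).comp hta)
    rw [map_zero, add_zero] at this
    refine this.congr fun j => ?_
    simp only [hx, Function.comp, hΓa, map_smul, map_sub, smul_sub]
    abel
  have htx : Tendsto (fun j => r j • (t j - θ0) - L (x j)) atTop (𝓝 0) := by
    refine hta.congr' ?_
    filter_upwards [ha, hc] with j h1 h2
    have : L (x j) = r j • a j := hL _ (C.smul_mem (hr j) h1) _ (K.smul_mem (hr j) h2)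
    rw [this, smul_sub]
  obtain ⟨Rx, hRx⟩ : ∃ R : ℝ, ∀ᶠ j in atTop, ‖x j‖ ≤ R := by
    refine ⟨Ru + 1, ?_⟩
    have := hux.norm.eventually_lt_const (show ‖(0 : Vec k)‖ < 1 by simp)
    filter_upwards [this, hRu] with j h1 h2
    have h3 : x j = r j • (m j - m0) - (r j • (m j - m0) - x j) := by abel
    rw [h3]
    refine (norm_sub_le _ _).trans ?_
    rw [norm_smul, Real.norm_of_nonneg (hr j).le]
    linarith
  -- cluster points of these points are nearest points of the cone
  have hxp : Tendsto x atTop (𝓝 p) := by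
    refine (isCompact_closedBall (0 : Vec k) Rx).tendsto_nhds_of_unique_mapClusterPt
      (hRx.mono fun j hj => by simpa using hj) fun y _ hcl => ?_
    obtain ⟨φ, hφ, hlim⟩ := hcl.tendsto_subseq
    refine hp y (mem_closure_of_tendsto hlim (hφ.tendsto_atTop.eventually hxS)) ?_
    rintro _ ⟨_, ⟨a', ha', rfl⟩, c', hc', rfl⟩
    obtain ⟨f, hf, hle⟩ := hcmp a' ha' c' hc'
    have hd : Tendsto (fun j => (G j - r j • (m j - m0)) - (G0 - x j)) atTop (𝓝 0) := by
      have := (tendsto_sub_nhds_zero_iff.2 hG).sub hux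
      rw [sub_zero] at this
      refine this.congr fun j => ?_
      abel
    have h1 := (tendsto_quad_sub_zero hε hq hR hd).comp hφ.tendsto_atTop
    have h2 : Tendsto (fun i => ‖T (G0 - x (φ i))‖ ^ 2) atTop (𝓝 (‖T (G0 - y)‖ ^ 2)) :=
      ((T.continuous.tendsto _).comp (hlim.const_sub G0)).norm.pow 2
    have h3 := h1.add h2
    rw [zero_add] at h3
    refine le_of_tendsto_of_tendsto h3 (hf.comp hφ.tendsto_atTop) ?_
    filter_upwards [hφ.tendsto_atTop.eventually hle] with i hi
    simpa using hi
  have := htx.add ((L.continuous.tendsto p).comp hxp)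
  rw [zero_add] at this
  refine this.congr fun j => ?_
  simp

/-! ### Metric projection on a convex set -/

/-- The variational inequality at the nearest point. -/
lemma inner_sub_metricProj_le {S : Set (Vec k)} (hne : S.Nonempty) (hconv : Convex ℝ S)
    (z : Vec k) {s : Vec k} (hs : s ∈ closure S) :
    inner ℝ (z - metricProj S z) (s - metricProj S z) ≤ 0 := by
  obtain ⟨hp, h⟩ := (metricProj_spec hne hconv z _).1 rfl
  refine (norm_eq_iInf_iff_real_inner_le_zero hconv.closure hp).1 ?_ s hs
  have : Nonempty (closure S) := hne.closure.to_subtype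
  refine le_antisymm (le_ciInf fun w => ?_) (ciInf_le ⟨0, ?_⟩ (⟨_, hp⟩ : closure S))
  · have hc : IsClosed {s : Vec k | ‖z - metricProj S z‖ ≤ ‖z - s‖} :=
      isClosed_le continuous_const (by fun_prop)
    exact closure_minimal (fun s hs => h s hs) hc w.2
  · rintro _ ⟨w, rfl⟩
    exact norm_nonneg _

/-- The metric projection on a convex set is nonexpansive. -/
lemma lipschitzWith_metricProj {S : Set (Vec k)} (hne : S.Nonempty) (hconv : Convex ℝ S) :
    LipschitzWith 1 (metricProj S) := by
  refine LipschitzWith.of_dist_le_mul fun z w => ?_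
  rw [NNReal.coe_one, one_mul, dist_eq_norm, dist_eq_norm]
  set p := metricProj S z
  set u := metricProj S w
  have hp : p ∈ closure S := ((metricProj_spec hne hconv z _).1 rfl).1
  have hu : u ∈ closure S := ((metricProj_spec hne hconv w _).1 rfl).1
  have h1 : inner ℝ (z - p) (u - p) ≤ 0 := inner_sub_metricProj_le hne hconv z hu
  have h2 : inner ℝ (w - u) (p - u) ≤ 0 := inner_sub_metricProj_le hne hconv w hp
  have h3 : ‖p - u‖ ^ 2 ≤ inner ℝ (z - w) (p - u) := by
    have e : inner ℝ (z - w) (p - u) =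
        ‖p - u‖ ^ 2 - inner ℝ (z - p) (u - p) - inner ℝ (w - u) (p - u) := by
      rw [← real_inner_self_eq_norm_sq, ← neg_sub p u, inner_neg_right, sub_neg_eq_add,
        ← inner_add_left, ← inner_sub_left]
      congr 1
      abel
    linarith
  have h4 := real_inner_le_norm (z - w) (p - u)
  by_contra! hlt
  have : 0 < ‖p - u‖ := (norm_nonneg _).trans_lt hlt
  nlinarith

/-! ### The inverse square root of a covariance matrix -/

/-- The square root of a positive definite matrix is invertible. -/
lemma isUnit_det_sqrt {S : Matrix (Fin k) (Fin k) ℝ} (hS : S.PosDef) :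
    IsUnit (CFC.sqrt S).det := by
  rw [← Matrix.isUnit_iff_isUnit_det, CFC.isUnit_sqrt_iff S hS.posSemidef.nonneg]
  exact hS.isUnit

/-- The operator `x ↦ S^{-1/2} x`, with `S^{-1/2}` the inverse of the positive square root. -/
noncomputable def invSqrtCLM (S : Matrix (Fin k) (Fin k) ℝ) : Vec k →L[ℝ] Vec k :=
  LinearMap.toContinuousLinearMap ((CFC.sqrt S)⁻¹).toEuclideanLin

/-- The operator `x ↦ S^{1/2} x`. -/
noncomputable def sqrtCLM (S : Matrix (Fin k) (Fin k) ℝ) : Vec k →L[ℝ] Vec k :=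
  LinearMap.toContinuousLinearMap (CFC.sqrt S).toEuclideanLin

lemma toEuclideanLin_mul_apply {l m n : ℕ} (A : Matrix (Fin l) (Fin m) ℝ)
    (B : Matrix (Fin m) (Fin n) ℝ) (x : Vec n) :
    (A * B).toEuclideanLin x = A.toEuclideanLin (B.toEuclideanLin x) := by
  simp

lemma toEuclideanLin_one_apply (x : Vec k) :
    (1 : Matrix (Fin k) (Fin k) ℝ).toEuclideanLin x = x := by
  simp

lemma invSqrtCLM_sqrtCLM {S : Matrix (Fin k) (Fin k) ℝ} (hS : S.PosDef) (x : Vec k) :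
    invSqrtCLM S (sqrtCLM S x) = x := by
  change ((CFC.sqrt S)⁻¹).toEuclideanLin ((CFC.sqrt S).toEuclideanLin x) = x
  rw [← toEuclideanLin_mul_apply, Matrix.nonsing_inv_mul _ (isUnit_det_sqrt hS),
    toEuclideanLin_one_apply]

lemma sqrtCLM_invSqrtCLM {S : Matrix (Fin k) (Fin k) ℝ} (hS : S.PosDef) (x : Vec k) :
    sqrtCLM S (invSqrtCLM S x) = x := by
  change (CFC.sqrt S).toEuclideanLin (((CFC.sqrt S)⁻¹).toEuclideanLin x) = x
  rw [← toEuclideanLin_mul_apply, Matrix.mul_nonsing_inv _ (isUnit_det_sqrt hS),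
    toEuclideanLin_one_apply]

lemma sqrt_transpose (S : Matrix (Fin k) (Fin k) ℝ) : (CFC.sqrt S)ᵀ = CFC.sqrt S := by
  have := (CFC.sqrt_nonneg S).posSemidef.isHermitian.eq
  rwa [Matrix.conjTranspose_eq_transpose_of_trivial] at this

lemma inv_sqrt_mul_inv_sqrt {S : Matrix (Fin k) (Fin k) ℝ} (hS : S.PosDef) :
    (CFC.sqrt S)⁻¹ * (CFC.sqrt S)⁻¹ = S⁻¹ := by
  rw [← Matrix.mul_inv_rev, CFC.sqrt_mul_sqrt_self S hS.posSemidef.nonneg]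

/-- Inner products of images under `S^{-1/2}`. -/
lemma inner_invSqrtCLM {S : Matrix (Fin k) (Fin k) ℝ} (hS : S.PosDef) (x y : Vec k) :
    inner ℝ (invSqrtCLM S x) (invSqrtCLM S y) = x.ofLp ⬝ᵥ (S⁻¹ *ᵥ y.ofLp) := by
  have e : ∀ v : Vec k, (invSqrtCLM S v).ofLp = (CFC.sqrt S)⁻¹ *ᵥ v.ofLp := fun v => rfl
  rw [EuclideanSpace.inner_eq_star_dotProduct, star_trivial, e, e, dotProduct_comm,
    ← inv_sqrt_mul_inv_sqrt hS, ← Matrix.mulVec_mulVec, Matrix.dotProduct_mulVec x.ofLp,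
    ← Matrix.mulVec_transpose, Matrix.transpose_nonsing_inv, sqrt_transpose]

lemma invQuad_eq_norm_sq {S : Matrix (Fin k) (Fin k) ℝ} (hS : S.PosDef) (x : Vec k) :
    invQuad S x = ‖invSqrtCLM S x‖ ^ 2 := by
  rw [← real_inner_self_eq_norm_sq, inner_invSqrtCLM hS]
  rfl

lemma invQuad_smul (S : Matrix (Fin k) (Fin k) ℝ) (c : ℝ) (x : Vec k) :
    invQuad S (c • x) = c ^ 2 * invQuad S x := by
  simp only [invQuad, WithLp.ofLp_smul, Matrix.mulVec_smul, smul_dotProduct, dotProduct_smul,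
    smul_eq_mul]
  ring

/-- The quadratic form is bounded below, since `S^{1/2}` is bounded. -/
lemma exists_le_norm_invSqrtCLM {S : Matrix (Fin k) (Fin k) ℝ} (hS : S.PosDef) :
    ∃ lam : ℝ, 0 < lam ∧ ∀ x, lam * ‖x‖ ^ 2 ≤ ‖invSqrtCLM S x‖ ^ 2 := by
  refine ⟨1 / (‖sqrtCLM S‖ + 1) ^ 2, by positivity, fun x => ?_⟩
  have h1 : ‖x‖ ≤ (‖sqrtCLM S‖ + 1) * ‖invSqrtCLM S x‖ := by
    conv_lhs => rw [← sqrtCLM_invSqrtCLM hS x]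
    refine ((sqrtCLM S).le_opNorm _).trans ?_
    exact mul_le_mul_of_nonneg_right (by linarith) (norm_nonneg _)
  rw [div_mul_eq_mul_div, one_mul, div_le_iff₀ (by positivity), mul_comm, ← mul_pow]
  exact pow_le_pow_left₀ (norm_nonneg _) h1 2

/-- Quadratic forms of close matrices are close, uniformly on the unit ball. -/
lemma abs_invQuad_sub_le (S S' : Matrix (Fin k) (Fin k) ℝ) (x : Vec k) :
    |invQuad S x - invQuad S' x| ≤ (∑ i, ∑ j, |S⁻¹ i j - S'⁻¹ i j|) * ‖x‖ ^ 2 := by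
  have e : invQuad S x - invQuad S' x = ∑ i, ∑ j, x i * ((S⁻¹ i j - S'⁻¹ i j) * x j) := by
    simp only [invQuad, dotProduct, Matrix.mulVec, Finset.mul_sum, ← Finset.sum_sub_distrib]
    refine Finset.sum_congr rfl fun i _ => Finset.sum_congr rfl fun j _ => by ring
  rw [e, Finset.sum_mul]
  refine (Finset.abs_sum_le_sum_abs _ _).trans (Finset.sum_le_sum fun i _ => ?_)
  rw [Finset.sum_mul]
  refine (Finset.abs_sum_le_sum_abs _ _).trans (Finset.sum_le_sum fun j _ => ?_)
  have hi : |x i| ≤ ‖x‖ := PiLp.norm_apply_le x i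
  have hj : |x j| ≤ ‖x‖ := PiLp.norm_apply_le x j
  rw [abs_mul, abs_mul]
  have := mul_le_mul hi hj (abs_nonneg _) (norm_nonneg _)
  nlinarith [abs_nonneg (S⁻¹ i j - S'⁻¹ i j)]

lemma tendsto_sum_abs_inv_sub_zero {ι : Type*} {l : Filter ι} {S : ι → Matrix (Fin k) (Fin k) ℝ}
    {S0 : Matrix (Fin k) (Fin k) ℝ} (hS0 : IsUnit S0.det)
    (h : ∀ i j, Tendsto (fun n => S n i j) l (𝓝 (S0 i j))) :
    Tendsto (fun n => ∑ i, ∑ j, |(S n)⁻¹ i j - S0⁻¹ i j|) l (𝓝 0) := by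
  have h1 : Tendsto S l (𝓝 S0) := tendsto_pi_nhds.2 fun i => tendsto_pi_nhds.2 fun j => h i j
  have hc : ContinuousAt Ring.inverse S0.det := by
    obtain ⟨u, hu⟩ := hS0
    rw [← hu]
    exact NormedRing.inverse_continuousAt u
  have h2 : Tendsto (fun n => (S n)⁻¹) l (𝓝 S0⁻¹) := (continuousAt_matrix_inv S0 hc).tendsto.comp h1
  have h3 : ∀ i j, Tendsto (fun n => |(S n)⁻¹ i j - S0⁻¹ i j|) l (𝓝 0) := by
    intro i j
    have := tendsto_pi_nhds.1 (tendsto_pi_nhds.1 h2 i) j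
    simpa using (tendsto_sub_nhds_zero_iff.2 this).abs
  simpa using tendsto_finsetSum Finset.univ fun i _ =>
    tendsto_finsetSum Finset.univ fun j _ => h3 i j

/-! ### Nearest points of the tangent cone -/

section Cone

variable (S : Matrix (Fin k) (Fin k) ℝ) (γ : Matrix (Fin k) (Fin d) ℝ) (C : ConvexCone ℝ (Vec d))
  (K : ConvexCone ℝ (Vec k))

lemma scaledCone_nonempty (hC : (C : Set (Vec d)).Nonempty) (hK : (K : Set (Vec k)).Nonempty) :
    (scaledCone S γ (C : Set (Vec d)) (K : Set (Vec k))).Nonempty :=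
  ((hC.image _).add hK).image _

lemma convex_scaledCone : Convex ℝ (scaledCone S γ (C : Set (Vec d)) (K : Set (Vec k))) :=
  ((C.convex.linear_image _).add K.convex).linear_image _

/-- The point of the closure of `γ C + K` nearest to `x` in the norm `‖S^{-1/2} ·‖`. -/
noncomputable def coneProj (x : Vec k) : Vec k :=
  sqrtCLM S (metricProj (scaledCone S γ C K) (invSqrtCLM S x))

lemma continuous_coneProj (hC : (C : Set (Vec d)).Nonempty) (hK : (K : Set (Vec k)).Nonempty) :
    Continuous (coneProj S γ C K) :=
  (sqrtCLM S).continuous.comp ((lipschitzWith_metricProj (scaledCone_nonempty S γ C K hC hK)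
    (convex_scaledCone S γ C K)).continuous.comp (invSqrtCLM S).continuous)

variable {S γ C K}

lemma eq_coneProj_of_forall_le (hS : S.PosDef)
    (hC : (C : Set (Vec d)).Nonempty) (hK : (K : Set (Vec k)).Nonempty) {G x : Vec k}
    (hx : x ∈ closure (γ.toEuclideanLin '' (C : Set (Vec d)) + (K : Set (Vec k))))
    (hmin : ∀ s ∈ γ.toEuclideanLin '' (C : Set (Vec d)) + (K : Set (Vec k)),
      ‖invSqrtCLM S (G - x)‖ ^ 2 ≤ ‖invSqrtCLM S (G - s)‖ ^ 2) :
    x = coneProj S γ C K G := by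
  have : metricProj (scaledCone S γ C K) (invSqrtCLM S G) = invSqrtCLM S x := by
    rw [metricProj_spec (scaledCone_nonempty S γ C K hC hK) (convex_scaledCone S γ C K)]
    refine ⟨image_closure_subset_closure_image (invSqrtCLM S).continuous ⟨x, hx, rfl⟩, ?_⟩
    rintro _ ⟨s, hs, rfl⟩
    have := (pow_le_pow_iff_left₀ (norm_nonneg _) (norm_nonneg _) two_ne_zero).1 (hmin s hs)
    rw [map_sub, map_sub] at this
    exact this
  rw [coneProj, this, sqrtCLM_invSqrtCLM hS]

end Cone

/-! ### The criterion -/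

/-- A near minimizer of the criterion comes with a moment vector that nearly minimizes the
quadratic form over all moment vectors of all parameters. -/
lemma exists_moment_near_minimizer {g : 𝒵 → Vec k} {𝓜 : Vec d → Set (ProbabilityMeasure 𝒵)}
    {Θ : Set (Vec d)} {S : Matrix (Fin k) (Fin k) ℝ} {e : Vec k} (hpos : ∀ x, 0 ≤ invQuad S x)
    {θ0 : Vec d} (h0 : θ0 ∈ Θ) (hne : (𝓜 θ0).Nonempty) {θ : Vec d} {δ δ' : ℝ} (hδ : δ < δ')
    (h : criterion g (𝓜 θ) S e ≤ (⨅ θ ∈ Θ, criterion g (𝓜 θ) S e) + (δ : EReal)) :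
    ∃ m ∈ momentSet g (𝓜 θ), ∀ θ' ∈ Θ, ∀ m' ∈ momentSet g (𝓜 θ'),
      invQuad S (e - m) ≤ invQuad S (e - m') + δ' := by
  set I := ⨅ θ ∈ Θ, criterion g (𝓜 θ) S e with hI
  have hIle : ∀ θ' ∈ Θ, ∀ m' ∈ momentSet g (𝓜 θ'), I ≤ ((invQuad S (e - m') : ℝ) : EReal) := by
    rintro θ' hθ' _ ⟨μ, hμ, rfl⟩
    exact (iInf₂_le θ' hθ').trans (iInf₂_le μ hμ)
  have hI0 : (0 : EReal) ≤ I :=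
    le_iInf₂ fun θ' _ => le_iInf₂ fun μ _ => EReal.coe_nonneg.2 (hpos _)
  have hItop : I ≠ ⊤ := by
    obtain ⟨μ, hμ⟩ := hne
    exact ((hIle θ0 h0 _ ⟨μ, hμ, rfl⟩).trans_lt (EReal.coe_lt_top _)).ne
  lift I to ℝ using ⟨hItop, (EReal.bot_lt_zero.trans_le hI0).ne'⟩ with i
  have hlt : criterion g (𝓜 θ) S e < ((i + δ' : ℝ) : EReal) := by
    refine h.trans_lt ?_
    rw [← EReal.coe_add]
    exact EReal.coe_lt_coe_iff.2 (by linarith)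
  simp only [criterion, iInf_lt_iff] at hlt
  obtain ⟨μ, hμ, hlt⟩ := hlt
  refine ⟨moment g μ, ⟨μ, hμ, rfl⟩, fun θ' hθ' m' hm' => ?_⟩
  have h1 := EReal.coe_lt_coe_iff.1 hlt
  have h2 := EReal.coe_le_coe_iff.1 (hIle θ' hθ' m' hm')
  linarith

/-- A positive value of the lower semicontinuous criterion keeps the moments of nearby parameters
away from `m0`. -/
lemma exists_le_norm_moment_sub {g : 𝒵 → Vec k} {𝓜 : Vec d → Set (ProbabilityMeasure 𝒵)}
    {Θ : Set (Vec d)} {S : Matrix (Fin k) (Fin k) ℝ} (hS : S.PosDef) {m0 : Vec k}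
    (hlsc : LowerSemicontinuousOn (fun θ => criterion g (𝓜 θ) S m0) Θ)
    {θ : Vec d} (hθ : θ ∈ Θ) (hne : criterion g (𝓜 θ) S m0 ≠ 0) :
    ∃ η : ℝ, 0 < η ∧ ∀ᶠ θ' in 𝓝[Θ] θ, ∀ m ∈ momentSet g (𝓜 θ'), η ≤ ‖m - m0‖ := by
  have h0 : (0 : EReal) < criterion g (𝓜 θ) S m0 := by
    refine lt_of_le_of_ne (le_iInf₂ fun μ _ => EReal.coe_nonneg.2 ?_) hne.symm
    rw [invQuad_eq_norm_sq hS]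
    positivity
  obtain ⟨w, hw0, hw⟩ := EReal.lt_iff_exists_real_btwn.1 h0
  have hw0' : 0 < w := EReal.coe_pos.1 hw0
  set N := ‖invSqrtCLM S‖ + 1
  have hN : 0 < N := by positivity
  refine ⟨Real.sqrt w / N, by positivity, ?_⟩
  filter_upwards [hlsc θ hθ w hw] with θ' hθ'
  rintro _ ⟨μ, hμ, rfl⟩
  have h1 : w < invQuad S (m0 - moment g μ) :=
    EReal.coe_lt_coe_iff.1 (hθ'.trans_le (iInf₂_le μ hμ))
  rw [invQuad_eq_norm_sq hS] at h1
  rw [div_le_iff₀ hN, norm_sub_rev]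
  refine Real.sqrt_le_iff.2 ⟨by positivity, h1.le.trans ?_⟩
  refine pow_le_pow_left₀ (norm_nonneg _) (((invSqrtCLM S).le_opNorm _).trans ?_) 2
  rw [mul_comm]
  exact mul_le_mul_of_nonneg_left (by linarith) (norm_nonneg _)

/-! ### Second moments of the moment function -/

lemma integrable_centered_mul {g : 𝒵 → Vec k} {μ : ProbabilityMeasure 𝒵}
    (hg : MemLp g 2 (μ : Measure 𝒵)) (i j : Fin k) :
    Integrable (fun z => (g z i - moment g μ i) * (g z j - moment g μ j)) (μ : Measure 𝒵) := by
  have h : ∀ i : Fin k, MemLp (fun z => g z i - moment g μ i) 2 (μ : Measure 𝒵) := fun i =>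
    (hg.eval_piLp i).sub (memLp_const _)
  exact (h i).integrable_mul (h j)

lemma crossMoment_toEuclideanLin {p q : ℕ} {g : 𝒵 → Vec k} {μ : ProbabilityMeasure 𝒵}
    (hg : MemLp g 2 (μ : Measure 𝒵)) (A : Matrix (Fin p) (Fin k) ℝ)
    (B : Matrix (Fin q) (Fin k) ℝ) :
    crossMoment μ (fun z => A.toEuclideanLin (g z - moment g μ))
      (fun z => B.toEuclideanLin (g z - moment g μ)) = A * momentCov g μ * Bᵀ := by
  ext i j
  have e : ∀ z, A.toEuclideanLin (g z - moment g μ) i * B.toEuclideanLin (g z - moment g μ) j =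
      ∑ b, ∑ a, A i a * ((g z a - moment g μ a) * (g z b - moment g μ b)) * B j b := by
    intro z
    simp only [Matrix.toLpLin_apply, Matrix.mulVec, dotProduct]
    rw [Finset.sum_mul_sum, Finset.sum_comm]
    refine Finset.sum_congr rfl fun b _ => Finset.sum_congr rfl fun a _ => ?_
    simp only [PiLp.sub_apply]
    ring
  have hint : ∀ a b, Integrable
      (fun z => A i a * ((g z a - moment g μ a) * (g z b - moment g μ b)) * B j b)
      (μ : Measure 𝒵) := fun a b =>
    ((integrable_centered_mul hg a b).const_mul _).mul_const _
  simp only [crossMoment, Matrix.of_apply, e, Matrix.mul_apply, Matrix.transpose_apply]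
  rw [integral_finsetSum _ fun b _ => integrable_finsetSum _ fun a _ => hint a b]
  refine Finset.sum_congr rfl fun b _ => ?_
  rw [integral_finsetSum _ fun a _ => hint a b, Finset.sum_mul]
  refine Finset.sum_congr rfl fun a _ => ?_
  rw [integral_mul_const, integral_const_mul]
  rfl

/-- A nonsingular covariance matrix is positive definite. -/
lemma posDef_momentCov {g : 𝒵 → Vec k} {μ : ProbabilityMeasure 𝒵}
    (hg : MemLp g 2 (μ : Measure 𝒵)) (hdet : IsUnit (momentCov g μ).det) :
    (momentCov g μ).PosDef := by
  have hps : (momentCov g μ).PosSemidef := by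
    refine Matrix.PosSemidef.of_dotProduct_mulVec_nonneg ?_ fun x => ?_
    · ext i j
      simp only [Matrix.conjTranspose_apply, star_trivial, momentCov, Matrix.of_apply]
      exact integral_congr_ae (.of_forall fun z => mul_comm _ _)
    · have h := crossMoment_toEuclideanLin hg (Matrix.of fun _ : Fin 1 => x)
        (Matrix.of fun _ : Fin 1 => x)
      have h1 := congrFun (congrFun h 0) 0
      have h2 : star x ⬝ᵥ (momentCov g μ *ᵥ x) = (Matrix.of (fun _ : Fin 1 => x) *
          momentCov g μ * (Matrix.of fun _ : Fin 1 => x)ᵀ) 0 0 := by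
        rw [star_trivial, Matrix.dotProduct_mulVec]
        rfl
      rw [h2, ← h1]
      simp only [crossMoment, Matrix.of_apply]
      exact integral_nonneg fun z => mul_self_nonneg _
  exact hps.posDef_iff_isUnit.2 ((Matrix.isUnit_iff_isUnit_det _).2 hdet)

/-! ### Uniform expansion of the estimator -/

section Estimation

variable {P : Measure Ω} [IsProbabilityMeasure P] {Z : ℕ → Ω → 𝒵}
    {g : 𝒵 → Vec k} {μs : ProbabilityMeasure 𝒵} {𝓜 : Vec d → Set (ProbabilityMeasure 𝒵)}
    {Θ : Set (Vec d)} {θ0 : Vec d} {Sn : ℕ → Ω → Matrix (Fin k) (Fin k) ℝ}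
    {γ : Matrix (Fin k) (Fin d) ℝ} {K : ConvexCone ℝ (Vec k)} {C : ConvexCone ℝ (Vec d)}

lemma Assumptions.cone_nonempty (hA : Assumptions P Z g μs 𝓜 Θ θ0 Sn γ K C) :
    (C : Set (Vec d)).Nonempty ∧ (K : Set (Vec k)).Nonempty := by
  have h : (0 : Vec k) ∈ (γ.toEuclideanLin '' ((C : Set (Vec d)) - (C : Set (Vec d)))) ∩
      ((K : Set (Vec k)) - (K : Set (Vec k))) := by
    rw [hA.transversal]
    rfl
  obtain ⟨⟨_, ⟨a, ha, _⟩, _⟩, c, hc, _⟩ := h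
  exact ⟨⟨a, ha⟩, ⟨c, hc⟩⟩

lemma Assumptions.posDef (hA : Assumptions P Z g μs 𝓜 Θ θ0 Sn γ K C) :
    (momentCov g μs).PosDef :=
  posDef_momentCov hA.memLp_g hA.nonsingular

/-- The deterministic limit theorem, uniformly over sample means within `O(n^{-1/2})` of the
population mean, weight matrices near the covariance matrix, and near minimizers. -/
theorem Assumptions.uniform_expansion (hA : Assumptions P Z g μs 𝓜 Θ θ0 Sn γ K C)
    (L : Vec k →L[ℝ] Vec d) (hL : ∀ a ∈ C, ∀ c ∈ K, L (γ.toEuclideanLin a + c) = a)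
    {ε : ℝ} (hε : 0 < ε) (R : ℝ) :
    ∃ δ : ℝ, 0 < δ ∧ ∀ᶠ n : ℕ in atTop, ∀ (e : Vec k) (S : Matrix (Fin k) (Fin k) ℝ), ∀ θ ∈ Θ,
      ‖Real.sqrt n • (e - moment g μs)‖ ≤ R → (∀ i j, |S i j - momentCov g μs i j| < δ) →
      criterion g (𝓜 θ) S e ≤ (⨅ θ ∈ Θ, criterion g (𝓜 θ) S e) + ((δ / n : ℝ) : EReal) →
      ‖Real.sqrt n • (θ - θ0) -
        L (coneProj (momentCov g μs) γ C K (Real.sqrt n • (e - moment g μs)))‖ < ε := by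
  obtain ⟨hC, hK⟩ := hA.cone_nonempty
  have hS := hA.posDef
  set m0 := moment g μs
  set Sig := momentCov g μs
  by_contra! hcon
  -- a sequence of violations with vanishing tolerances
  have hseq : ∀ j : ℕ, ∃ n : ℕ, j + 1 ≤ n ∧ ∃ (e : Vec k) (S : Matrix (Fin k) (Fin k) ℝ),
      ∃ θ ∈ Θ, ‖Real.sqrt n • (e - m0)‖ ≤ R ∧ (∀ i i', |S i i' - Sig i i'| < 1 / ((j : ℝ) + 1)) ∧
      criterion g (𝓜 θ) S e ≤ (⨅ θ ∈ Θ, criterion g (𝓜 θ) S e) +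
        (((1 / ((j : ℝ) + 1)) / n : ℝ) : EReal) ∧
      ε ≤ ‖Real.sqrt n • (θ - θ0) - L (coneProj Sig γ C K (Real.sqrt n • (e - m0)))‖ := by
    intro j
    obtain ⟨n, hn, h⟩ := frequently_atTop.1 (hcon (1 / ((j : ℝ) + 1)) (by positivity)) (j + 1)
    exact ⟨n, hn, h⟩
  choose n hn e S θ hθ hR hSj hcrit hbad using hseq
  obtain ⟨G0, -, φ, hφ, hG⟩ := (isCompact_closedBall (0 : Vec k) R).tendsto_subseq
    (x := fun j => Real.sqrt (n j) • (e j - m0)) (fun j => by simpa using hR j)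
  have hφt := hφ.tendsto_atTop
  have hinv : Tendsto (fun j : ℕ => 1 / ((φ j : ℝ) + 1)) atTop (𝓝 0) :=
    (tendsto_one_div_add_atTop_nhds_zero_nat (𝕜 := ℝ)).comp hφt
  have hnpos : ∀ j, (0 : ℝ) < n j := fun j => by
    have := hn j
    exact_mod_cast (show 0 < n j by omega)
  have hr : ∀ j, 0 < Real.sqrt (n (φ j)) := fun j => Real.sqrt_pos.2 (hnpos _)
  have hrt : Tendsto (fun j => Real.sqrt (n (φ j))) atTop atTop := by
    have h1 : Tendsto n atTop atTop :=
      tendsto_atTop_mono (fun j => (Nat.le_succ j).trans (hn j)) tendsto_id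
    exact Real.tendsto_sqrt_atTop.comp (tendsto_natCast_atTop_atTop.comp (h1.comp hφt))
  have hSlim : ∀ i j, Tendsto (fun l => S (φ l) i j) atTop (𝓝 (Sig i j)) := by
    intro i j
    rw [← tendsto_sub_nhds_zero_iff]
    exact squeeze_zero_norm (fun l => (hSj (φ l) i j).le) hinv
  have hep := tendsto_sum_abs_inv_sub_zero hA.nonsingular hSlim
  have hq : ∀ j, ∀ x, |invQuad (S (φ j)) x - ‖invSqrtCLM Sig x‖ ^ 2| ≤
      (∑ i, ∑ i', |(S (φ j))⁻¹ i i' - Sig⁻¹ i i'|) * ‖x‖ ^ 2 := by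
    intro j x
    rw [← invQuad_eq_norm_sq hS]
    exact abs_invQuad_sub_le _ _ _
  obtain ⟨lam, hlam, hT⟩ := exists_le_norm_invSqrtCLM hS
  have hne0 : (𝓜 θ0).Nonempty := by
    by_contra hem
    rw [Set.not_nonempty_iff_eq_empty] at hem
    have := hA.solves
    simp [hem, criterion] at this
  -- moment vectors that realize the near minimum
  have hex : ∀ᶠ j in atTop, ∃ m ∈ momentSet g (𝓜 (θ (φ j))), ∀ θ' ∈ Θ,
      ∀ m' ∈ momentSet g (𝓜 θ'), invQuad (S (φ j)) (e (φ j) - m) ≤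
        invQuad (S (φ j)) (e (φ j) - m') + 2 * (1 / ((φ j : ℝ) + 1)) / n (φ j) := by
    filter_upwards [hep.eventually_lt_const hlam] with j hj
    refine exists_moment_near_minimizer (fun x => ?_) hA.mem_param hne0 ?_ (hcrit (φ j))
    · have h1 := (abs_le.1 (hq j x)).1
      have h2 := hT x
      nlinarith [sq_nonneg ‖x‖]
    · have h1 : 0 < 1 / ((φ j : ℝ) + 1) := by positivity
      exact div_lt_div_of_pos_right (by linarith) (hnpos _)
  classical
  let m : ℕ → Vec k := fun j => if h : ∃ m ∈ momentSet g (𝓜 (θ (φ j))), ∀ θ' ∈ Θ,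
      ∀ m' ∈ momentSet g (𝓜 θ'), invQuad (S (φ j)) (e (φ j) - m) ≤
        invQuad (S (φ j)) (e (φ j) - m') + 2 * (1 / ((φ j : ℝ) + 1)) / n (φ j)
    then h.choose else 0
  have hm : ∀ᶠ j in atTop, m j ∈ momentSet g (𝓜 (θ (φ j))) ∧ ∀ θ' ∈ Θ,
      ∀ m' ∈ momentSet g (𝓜 θ'), invQuad (S (φ j)) (e (φ j) - m j) ≤
        invQuad (S (φ j)) (e (φ j) - m') + 2 * (1 / ((φ j : ℝ) + 1)) / n (φ j) := by
    filter_upwards [hex] with j hj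
    simp only [m, dif_pos hj]
    exact hj.choose_spec
  have hη : Tendsto (fun j : ℕ => 2 * (1 / ((φ j : ℝ) + 1))) atTop (𝓝 0) := by
    have := hinv.const_mul 2
    rwa [mul_zero] at this
  have hlim := tendsto_smul_sub_of_near_minimizer (p := coneProj Sig γ C K G0)
    hA.chernoff_moments hA.chernoff_param hA.compact_param
    (fun θ hθ hne => exists_le_norm_moment_sub hS hA.lsc hθ fun h => hne (hA.unique θ hθ h))
    hC hK L hL hlam hT hr hrt hep (.of_forall hq) hG hη
    (.of_forall fun j => hθ (φ j)) (hm.mono fun j h => h.1) (by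
      filter_upwards [hm] with j hj θ' hθ' m' hm'
      have e1 : ∀ v : Vec k, Real.sqrt (n (φ j)) • (e (φ j) - m0) -
          Real.sqrt (n (φ j)) • (v - m0) = Real.sqrt (n (φ j)) • (e (φ j) - v) := by
        intro v
        rw [← smul_sub, sub_sub_sub_cancel_right]
      have h1 := hj.2 θ' hθ' m' hm'
      have h2 := mul_le_mul_of_nonneg_left h1 (hnpos (φ j)).le
      rw [mul_add, mul_div_cancel₀ _ (hnpos (φ j)).ne'] at h2
      change invQuad _ (Real.sqrt (n (φ j)) • (e (φ j) - m0) - Real.sqrt (n (φ j)) • (m j - m0)) ≤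
        invQuad _ (Real.sqrt (n (φ j)) • (e (φ j) - m0) - Real.sqrt (n (φ j)) • (m' - m0)) + _
      rw [e1, e1, invQuad_smul, invQuad_smul, Real.sq_sqrt (hnpos (φ j)).le]
      exact h2)
    fun x hx hxmin => eq_coneProj_of_forall_le hS hC hK hx hxmin
  have hF : Tendsto (fun j => L (coneProj Sig γ C K
      (Real.sqrt (n (φ j)) • (e (φ j) - m0)))) atTop (𝓝 (L (coneProj Sig γ C K G0))) :=
    ((L.continuous.comp (continuous_coneProj Sig γ C K hC hK)).tendsto G0).comp hG
  have h0 := (hlim.sub hF).norm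
  rw [sub_self, norm_zero] at h0
  obtain ⟨j, hj⟩ := (h0.eventually_lt_const hε).exists
  exact absurd (hbad (φ j)) (not_le.2 hj)

/-! ### Passage to convergence in distribution -/

/-- A sequence that converges in distribution is bounded in probability. -/
lemma exists_eventually_measure_norm_gt_lt {E Ω' : Type*} [NormedAddCommGroup E]
    [NormedSpace ℝ E] [FiniteDimensional ℝ E] [MeasurableSpace E] [BorelSpace E]
    [MeasurableSpace Ω'] {ν : Measure Ω'} [IsProbabilityMeasure ν] {X : ℕ → Ω → E} {Y : Ω' → E}
    (h : TendstoInDistribution X atTop Y (fun _ => P) ν) {η : ℝ≥0∞} (hη : 0 < η) :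
    ∃ R : ℝ, ∀ᶠ n in atTop, P {ω | R < ‖X n ω‖} < η := by
  have hYm := h.aemeasurable_limit
  have : IsProbabilityMeasure (ν.map Y) := Measure.isProbabilityMeasure_map hYm
  have ht := tendsto_measure_norm_gt_of_isTightMeasureSet
    (isTightMeasureSet_singleton (μ := ν.map Y))
  simp only [Set.mem_singleton_iff, iSup_iSup_eq_left] at ht
  obtain ⟨R, hR⟩ := (ht.eventually_lt_const hη).exists
  refine ⟨R + 1, ?_⟩
  have hcl : IsClosed {x : E | R + 1 ≤ ‖x‖} := isClosed_le continuous_const continuous_norm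
  have hlim := ProbabilityMeasure.limsup_measure_closed_le_of_tendsto h.tendsto hcl
  have hlt := hlim.trans_lt ((measure_mono fun x (hx : R + 1 ≤ ‖x‖) =>
    (show R < ‖x‖ by linarith)).trans_lt hR)
  filter_upwards [eventually_lt_of_limsup_lt hlt] with n hn
  refine lt_of_le_of_lt ?_ hn
  simp only [ProbabilityMeasure.coe_mk]
  rw [Measure.map_apply_of_aemeasurable (h.forall_aemeasurable n) hcl.measurableSet]
  exact measure_mono fun ω (hω : R + 1 < ‖X n ω‖) => hω.le

/-- The scaled estimation error equals a continuous function of the scaled sample mean, up to a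
term that vanishes in probability. -/
theorem Assumptions.tendstoInMeasure_sub (hA : Assumptions P Z g μs 𝓜 Θ θ0 Sn γ K C)
    {θhat : ℕ → Ω → Vec d} (hθ : IsApproxMinimizer P Z g 𝓜 Θ Sn θhat)
    (L : Vec k →L[ℝ] Vec d) (hL : ∀ a ∈ C, ∀ c ∈ K, L (γ.toEuclideanLin a + c) = a) :
    TendstoInMeasure P ((fun (n : ℕ) ω => Real.sqrt n • (θhat n ω - θ0)) -
      fun (n : ℕ) ω => L (coneProj (momentCov g μs) γ C K
        (Real.sqrt n • (sampleMean g Z n ω - moment g μs)))) atTop 0 := by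
  rw [tendstoInMeasure_iff_norm]
  intro ε hε
  rw [ENNReal.tendsto_nhds_zero]
  intro η hη
  obtain ⟨η', hη', hle⟩ : ∃ η' : ℝ≥0∞, 0 < η' ∧ η' + η' ≤ η :=
    ⟨η / 2, ENNReal.half_pos hη.ne', (ENNReal.add_halves η).le⟩
  obtain ⟨R, hR⟩ := exists_eventually_measure_norm_gt_lt hA.clt hη'
  obtain ⟨δ, hδ, hδn⟩ := hA.uniform_expansion L hL hε R
  have hS : Tendsto (fun n => ∑ i, ∑ j,
      P {ω | δ ≤ ‖Sn n ω i j - momentCov g μs i j‖}) atTop (𝓝 0) := by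
    simpa using tendsto_finsetSum Finset.univ fun i _ => tendsto_finsetSum Finset.univ fun j _ =>
      tendstoInMeasure_iff_norm.1 (hA.consistent i j) δ hδ
  have hsum := hS.add (hθ.approx δ hδ)
  rw [add_zero] at hsum
  filter_upwards [hR, hδn, hsum.eventually_lt_const hη'] with n h1 h2 h3
  have hsub : {ω | ε ≤ ‖((fun (n : ℕ) ω => Real.sqrt n • (θhat n ω - θ0)) -
      fun (n : ℕ) ω => L (coneProj (momentCov g μs) γ C K
        (Real.sqrt n • (sampleMean g Z n ω - moment g μs)))) n ω - (0 : ℕ → Ω → Vec d) n ω‖} ⊆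
      ({ω | R < ‖Real.sqrt n • (sampleMean g Z n ω - moment g μs)‖} ∪
      ((⋃ i, ⋃ j, {ω | δ ≤ ‖Sn n ω i j - momentCov g μs i j‖}) ∪
      {ω | (⨅ θ ∈ Θ, criterion g (𝓜 θ) (Sn n ω) (sampleMean g Z n ω)) + ((δ / n : ℝ) : EReal)
        < criterion g (𝓜 (θhat n ω)) (Sn n ω) (sampleMean g Z n ω)})) ∪
      {ω | θhat n ω ∉ Θ} := by
    intro ω hω
    by_contra hnot
    simp only [Set.mem_union, Set.mem_iUnion, Set.mem_ofPred_eq, not_or, not_exists, not_le,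
      not_lt, not_not] at hnot
    obtain ⟨⟨i1, i2, i3⟩, i4⟩ := hnot
    have := h2 _ _ _ i4 i1 i2 i3
    simp only [Set.mem_ofPred_eq, Pi.sub_apply, Pi.zero_apply, sub_zero] at hω
    exact absurd hω (not_le.2 this)
  have hU : P (⋃ i, ⋃ j, {ω | δ ≤ ‖Sn n ω i j - momentCov g μs i j‖}) ≤
      ∑ i, ∑ j, P {ω | δ ≤ ‖Sn n ω i j - momentCov g μs i j‖} :=
    (measure_iUnion_fintype_le P _).trans
      (Finset.sum_le_sum fun i _ => measure_iUnion_fintype_le P _)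
  have h0 : P {ω | θhat n ω ∉ Θ} = 0 := ae_iff.1 (hθ.mem n)
  calc _ ≤ _ := measure_mono hsub
    _ ≤ _ := measure_union_le _ _
    _ ≤ P {ω | R < ‖Real.sqrt n • (sampleMean g Z n ω - moment g μs)‖} +
        (∑ i, ∑ j, P {ω | δ ≤ ‖Sn n ω i j - momentCov g μs i j‖} +
        P {ω | (⨅ θ ∈ Θ, criterion g (𝓜 θ) (Sn n ω) (sampleMean g Z n ω)) + ((δ / n : ℝ) : EReal)
          < criterion g (𝓜 (θhat n ω)) (Sn n ω) (sampleMean g Z n ω)}) := by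
      rw [h0, add_zero]
      refine (measure_union_le _ _).trans (add_le_add le_rfl ?_)
      exact (measure_union_le _ _).trans (add_le_add hU le_rfl)
    _ ≤ η' + η' := add_le_add h1.le h3.le
    _ ≤ η := hle

/-- The limit law of the estimator as the law of a function of a Gaussian vector. -/
theorem Assumptions.tendstoInDistribution (hA : Assumptions P Z g μs 𝓜 Θ θ0 Sn γ K C)
    {θhat : ℕ → Ω → Vec d} (hθ : IsApproxMinimizer P Z g 𝓜 Θ Sn θhat)
    (L : Vec k →L[ℝ] Vec d) (hL : ∀ a ∈ C, ∀ c ∈ K, L (γ.toEuclideanLin a + c) = a) :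
    TendstoInDistribution (fun (n : ℕ) ω => Real.sqrt n • (θhat n ω - θ0)) atTop
      (fun x => L (coneProj (momentCov g μs) γ C K x)) (fun _ => P)
      (multivariateGaussian 0 (momentCov g μs)) := by
  obtain ⟨hC, hK⟩ := hA.cone_nonempty
  have hcont : Continuous fun x => L (coneProj (momentCov g μs) γ C K x) :=
    L.continuous.comp (continuous_coneProj _ γ C K hC hK)
  refine tendstoInDistribution_of_tendstoInMeasure_sub _ _ (hA.clt.continuous_comp
    (g := fun x => L (coneProj (momentCov g μs) γ C K x)) hcont)
    (hA.tendstoInMeasure_sub hθ L hL) fun n => ?_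
  have := hθ.aemeasurable n
  fun_prop

end Estimation

/-- Convergence in distribution depends on the limit only through its law. -/
lemma _root_.MeasureTheory.TendstoInDistribution.of_map_eq {E Ω₁ Ω₂ : Type*} [TopologicalSpace E]
    [MeasurableSpace E] [OpensMeasurableSpace E] [MeasurableSpace Ω₁] [MeasurableSpace Ω₂]
    {P : Measure Ω} [IsProbabilityMeasure P] {ν₁ : Measure Ω₁} [IsProbabilityMeasure ν₁]
    {ν₂ : Measure Ω₂} [IsProbabilityMeasure ν₂] {X : ℕ → Ω → E} {Y₁ : Ω₁ → E} {Y₂ : Ω₂ → E}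
    (h : TendstoInDistribution X atTop Y₁ (fun _ => P) ν₁) (hY : AEMeasurable Y₂ ν₂)
    (heq : ν₁.map Y₁ = ν₂.map Y₂) : TendstoInDistribution X atTop Y₂ (fun _ => P) ν₂ := by
  refine ⟨h.forall_aemeasurable, hY, ?_⟩
  have := h.tendsto
  simp only [heq] at this
  exact this

/-! ### Block matrices and full column rank -/

lemma injective_toEuclideanLin_of_rank {m n : ℕ} {A : Matrix (Fin m) (Fin n) ℝ}
    (h : A.rank = n) : Function.Injective A.toEuclideanLin := by
  have h1 := LinearMap.finrank_range_add_finrank_ker A.mulVecLin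
  have h2 : Module.finrank ℝ (LinearMap.range A.mulVecLin) = n := h
  rw [h2, Module.finrank_fin_fun] at h1
  have h3 : Function.Injective A.mulVecLin :=
    LinearMap.ker_eq_bot.1 (Submodule.finrank_eq_zero.1 (by omega))
  intro x y hxy
  have h4 : A.mulVecLin x.ofLp = A.mulVecLin y.ofLp := congrArg WithLp.ofLp hxy
  exact WithLp.ofLp_injective 2 (h3 h4)

lemma injective_mulVec_of_toEuclideanLin {m n : ℕ} {A : Matrix (Fin m) (Fin n) ℝ}
    (h : Function.Injective A.toEuclideanLin) : Function.Injective A.mulVec := by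
  intro x y hxy
  have : A.toEuclideanLin (WithLp.toLp 2 x) = A.toEuclideanLin (WithLp.toLp 2 y) :=
    congrArg (WithLp.toLp 2) hxy
  exact congrArg WithLp.ofLp (h this)

/-- The vector of `ℝ^k` with given first `l` and last `k - l` coordinates. -/
def joinCoords {l k : ℕ} (h : l ≤ k) (v : Vec l) (w : Vec (k - l)) : Vec k :=
  WithLp.toLp 2 fun i => Sum.elim v.ofLp w.ofLp ((splitCoords h).symm i)

lemma firstCoords_joinCoords {l k : ℕ} (h : l ≤ k) (v : Vec l) (w : Vec (k - l)) :
    firstCoords h (joinCoords h v w) = v := by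
  ext i
  simp [firstCoords, joinCoords]

lemma exists_eq_joinCoords {l k : ℕ} (h : l ≤ k) (x : Vec k) : ∃ v w, x = joinCoords h v w := by
  refine ⟨firstCoords h x, WithLp.toLp 2 fun i => x (splitCoords h (Sum.inr i)), ?_⟩
  ext i
  obtain ⟨s, rfl⟩ := (splitCoords h).surjective i
  cases s <;> simp [joinCoords, firstCoords]

lemma blockMatrix_joinCoords {l k : ℕ} (h : l ≤ k) (D : Matrix (Fin k) (Fin l) ℝ)
    (B : Matrix (Fin k) (Fin (k - l)) ℝ) (v : Vec l) (w : Vec (k - l)) :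
    (blockMatrix h D B).toEuclideanLin (joinCoords h v w) =
      D.toEuclideanLin v + B.toEuclideanLin w := by
  have e : blockMatrix h D B *ᵥ (joinCoords h v w).ofLp = D *ᵥ v.ofLp + B *ᵥ w.ofLp := by
    have h1 : (joinCoords h v w).ofLp = Sum.elim v.ofLp w.ofLp ∘ (splitCoords h).symm := rfl
    rw [blockMatrix, h1, Matrix.submatrix_mulVec_equiv, Function.comp_assoc]
    simp [Matrix.fromCols_mulVec]
  exact congrArg (WithLp.toLp 2) e

lemma isUnit_det_blockMatrix {l k : ℕ} (h : l ≤ k) {D : Matrix (Fin k) (Fin l) ℝ}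
    {B : Matrix (Fin k) (Fin (k - l)) ℝ} (hD : Function.Injective D.toEuclideanLin)
    (hB : Function.Injective B.toEuclideanLin)
    (hDB : Set.range B.toEuclideanLin ∩ Set.range D.toEuclideanLin = {0}) :
    IsUnit (blockMatrix h D B).det := by
  rw [← Matrix.isUnit_iff_isUnit_det, ← Matrix.mulVec_injective_iff_isUnit]
  refine injective_mulVec_of_toEuclideanLin ((injective_iff_map_eq_zero _).2 fun x hx => ?_)
  obtain ⟨v, w, rfl⟩ := exists_eq_joinCoords h x
  rw [blockMatrix_joinCoords] at hx
  have hmem : D.toEuclideanLin v ∈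
      Set.range B.toEuclideanLin ∩ Set.range D.toEuclideanLin :=
    ⟨⟨-w, by rw [map_neg]; exact (eq_neg_of_add_eq_zero_left hx).symm⟩, v, rfl⟩
  rw [hDB, Set.mem_singleton_iff] at hmem
  rw [hmem, zero_add] at hx
  rw [(map_eq_zero_iff _ hD).1 hmem, (map_eq_zero_iff _ hB).1 hx]
  ext i
  obtain ⟨s, rfl⟩ := (splitCoords h).surjective i
  cases s <;> simp [joinCoords]

/-- The coordinate projection `v ↦ [v]_l` as a linear map. -/
def firstCoordsLin {l k : ℕ} (h : l ≤ k) : Vec k →ₗ[ℝ] Vec l where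
  toFun := firstCoords h
  map_add' _ _ := rfl
  map_smul' _ _ := rfl

/-- The cone need not contain `0`, so `a` is written as `2 a - a`. -/
lemma subset_sub_self {n : ℕ} (C : ConvexCone ℝ (Vec n)) :
    (C : Set (Vec n)) ⊆ (C : Set (Vec n)) - (C : Set (Vec n)) := by
  intro a ha
  exact ⟨(2 : ℝ) • a, C.smul_mem two_pos ha, a, ha, by rw [two_smul]; simp⟩

/-! ### Linear images of Gaussian measures -/

lemma map_multivariateGaussian {m n : ℕ} {S : Matrix (Fin n) (Fin n) ℝ} (hS : S.PosSemidef)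
    (A : Matrix (Fin m) (Fin n) ℝ) :
    (multivariateGaussian 0 S).map (LinearMap.toContinuousLinearMap A.toEuclideanLin) =
      multivariateGaussian 0 (A * S * Aᵀ) := by
  have hS' : (A * S * Aᵀ).PosSemidef := by
    have := hS.mul_mul_conjTranspose_same A
    rwa [Matrix.conjTranspose_eq_transpose_of_trivial] at this
  apply IsGaussian.ext
  · simp only [id_eq, integral_id_multivariateGaussian]
    rw [ContinuousLinearMap.integral_id_map IsGaussian.integrable_id,
      integral_id_multivariateGaussian, map_zero]
  · ext x y
    rw [covarianceBilin_map IsGaussian.memLp_two_id, covarianceBilin_multivariateGaussian hS,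
      covarianceBilin_multivariateGaussian hS', ← LinearMap.adjoint_toContinuousLinearMap,
      ← Matrix.toEuclideanLin_conjTranspose_eq_adjoint,
      Matrix.conjTranspose_eq_transpose_of_trivial]
    have e : ∀ v : Vec m, (LinearMap.toContinuousLinearMap (Aᵀ).toEuclideanLin v).ofLp =
        Aᵀ *ᵥ v.ofLp := fun v => rfl
    rw [e, e, ← Matrix.mulVec_mulVec, ← Matrix.mulVec_mulVec, Matrix.dotProduct_mulVec x.ofLp A,
      ← Matrix.mulVec_transpose]

/-! ### Scores and residuals -/

section Scores

variable {g : 𝒵 → Vec k} {μ : ProbabilityMeasure 𝒵}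

lemma crossMoment_scoreFn (hg : MemLp g 2 (μ : Measure 𝒵)) (hdet : IsUnit (momentCov g μ).det)
    {p q : ℕ} (D : Matrix (Fin k) (Fin p) ℝ) (E : Matrix (Fin k) (Fin q) ℝ) :
    crossMoment μ (scoreFn g μ D) (scoreFn g μ E) = Dᵀ * (momentCov g μ)⁻¹ * E := by
  have hsymm : (momentCov g μ)ᵀ = momentCov g μ := by
    have := (posDef_momentCov hg hdet).isHermitian.eq
    rwa [Matrix.conjTranspose_eq_transpose_of_trivial] at this
  have h := crossMoment_toEuclideanLin hg (Dᵀ * (momentCov g μ)⁻¹) (Eᵀ * (momentCov g μ)⁻¹)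
  rw [Matrix.transpose_mul, Matrix.transpose_transpose, Matrix.transpose_nonsing_inv, hsymm,
    Matrix.mul_assoc Dᵀ, Matrix.nonsing_inv_mul _ hdet, Matrix.mul_one, ← Matrix.mul_assoc] at h
  exact h

/-- The residual of the score of `γ` on the score of `B` is the score of `γ - B L'`. -/
lemma residual_scoreFn {p q : ℕ} (γ : Matrix (Fin k) (Fin p) ℝ) (B : Matrix (Fin k) (Fin q) ℝ) :
    residual μ (scoreFn g μ γ) (scoreFn g μ B) =
      scoreFn g μ (γ - B * (projCoef μ (scoreFn g μ γ) (scoreFn g μ B))ᵀ) := by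
  funext z
  simp only [residual]
  set L := projCoef μ (scoreFn g μ γ) (scoreFn g μ B)
  simp only [scoreFn]
  rw [Matrix.transpose_sub, Matrix.transpose_mul, Matrix.transpose_transpose, Matrix.sub_mul,
    Matrix.mul_assoc, map_sub Matrix.toEuclideanLin, LinearMap.sub_apply,
    toEuclideanLin_mul_apply L]

end Scores

/-- If `γ C + K` is a linear subspace, the projection residual is `S⁻¹`-orthogonal to it, since the
variational inequality holds in every direction and its opposite. -/
lemma dotProduct_sub_coneProj_eq_zero {S : Matrix (Fin k) (Fin k) ℝ} (hS : S.PosDef)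
    {γ : Matrix (Fin k) (Fin d) ℝ} {C : ConvexCone ℝ (Vec d)} {K : ConvexCone ℝ (Vec k)}
    (W : Submodule ℝ (Vec k))
    (hW : γ.toEuclideanLin '' (C : Set (Vec d)) + (K : Set (Vec k)) = W) (G : Vec k) {w : Vec k}
    (hw : w ∈ W) : w.ofLp ⬝ᵥ (S⁻¹ *ᵥ (G - coneProj S γ C K G).ofLp) = 0 := by
  let W' : Submodule ℝ (Vec k) := W.map ((CFC.sqrt S)⁻¹).toEuclideanLin
  have hsc : scaledCone S γ (C : Set (Vec d)) (K : Set (Vec k)) = W' := by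
    rw [scaledCone, hW]
    rfl
  have hne : (scaledCone S γ (C : Set (Vec d)) (K : Set (Vec k))).Nonempty := by
    rw [hsc]
    exact ⟨0, W'.zero_mem⟩
  have hconv := convex_scaledCone S γ C K
  set p := metricProj (scaledCone S γ C K) (invSqrtCLM S G) with hp
  have hcl : closure (scaledCone S γ (C : Set (Vec d)) (K : Set (Vec k))) = W' := by
    rw [hsc]
    exact (Submodule.closed_of_finiteDimensional W').closure_eq
  have hpW : p ∈ W' := by
    have := ((metricProj_spec hne hconv (invSqrtCLM S G) p).1 rfl).1
    rwa [hcl] at this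
  have hwW : invSqrtCLM S w ∈ W' := ⟨w, hw, rfl⟩
  have h1 : inner ℝ (invSqrtCLM S G - p) (p + invSqrtCLM S w - p) ≤ 0 :=
    inner_sub_metricProj_le hne hconv _ (by rw [hcl]; exact W'.add_mem hpW hwW)
  have h2 : inner ℝ (invSqrtCLM S G - p) (p - invSqrtCLM S w - p) ≤ 0 :=
    inner_sub_metricProj_le hne hconv _ (by rw [hcl]; exact W'.sub_mem hpW hwW)
  rw [add_sub_cancel_left] at h1
  rw [sub_sub_cancel_left, inner_neg_right] at h2
  have h3 : invSqrtCLM S (G - coneProj S γ C K G) = invSqrtCLM S G - p := by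
    rw [map_sub, coneProj, invSqrtCLM_sqrtCLM hS]
  rw [← inner_invSqrtCLM hS, h3, real_inner_comm]
  linarith

variable {P : Measure Ω} [IsProbabilityMeasure P] {Z : ℕ → Ω → 𝒵}
    {g : 𝒵 → Vec k} {μs : ProbabilityMeasure 𝒵} {𝓜 : Vec d → Set (ProbabilityMeasure 𝒵)}
    {Θ : Set (Vec d)} {θ0 : Vec d} {Sn : ℕ → Ω → Matrix (Fin k) (Fin k) ℝ}
    {γ : Matrix (Fin k) (Fin d) ℝ} {K : ConvexCone ℝ (Vec k)} {C : ConvexCone ℝ (Vec d)}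

/-! ### The two forms of the limit law -/

/-- The cone limit law. The map `L = A [R⁻¹ ·]_l` recovers `a` from `γ a + c`, because `R` has the
block columns `γ A` and `B` while `C` and `K` lie in the ranges of `A` and `B`. -/
theorem Assumptions.tendstoInDistribution_cone (hA : Assumptions P Z g μs 𝓜 Θ θ0 Sn γ K C)
    {θhat : ℕ → Ω → Vec d} (hθ : IsApproxMinimizer P Z g 𝓜 Θ Sn θhat)
    {l : ℕ} (hl : l ≤ k) {A : Matrix (Fin d) (Fin l) ℝ} {B : Matrix (Fin k) (Fin (k - l)) ℝ}
    (hAr : A.rank = l)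
    (hCA : (C : Set (Vec d)) - (C : Set (Vec d)) = Set.range A.toEuclideanLin)
    (hBr : B.rank = k - l)
    (hKB : (K : Set (Vec k)) - (K : Set (Vec k)) ⊆ Set.range B.toEuclideanLin)
    (hBA : Set.range B.toEuclideanLin ∩ Set.range (γ * A).toEuclideanLin = {0}) :
    IsUnit (blockMatrix hl (γ * A) B).det ∧
      TendstoInDistribution (fun (n : ℕ) ω => Real.sqrt n • (θhat n ω - θ0)) atTop
        (fun z : Vec k => A.toEuclideanLin (firstCoords hl
          (((blockMatrix hl (γ * A) B)⁻¹ * CFC.sqrt (momentCov g μs)).toEuclideanLin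
            (metricProj (scaledCone (momentCov g μs) γ C K) z))))
        (fun _ => P) (stdGaussian (Vec k)) := by
  obtain ⟨hC, hK⟩ := hA.cone_nonempty
  have hinj : Function.Injective (γ * A).toEuclideanLin := by
    intro x y hxy
    rw [toEuclideanLin_mul_apply, toEuclideanLin_mul_apply] at hxy
    exact injective_toEuclideanLin_of_rank hAr (injective_toEuclideanLin_of_rank hA.full_rank hxy)
  have hdet := isUnit_det_blockMatrix hl hinj (injective_toEuclideanLin_of_rank hBr) hBA
  refine ⟨hdet, ?_⟩
  set R := blockMatrix hl (γ * A) B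
  set S := momentCov g μs
  let L : Vec k →L[ℝ] Vec d := LinearMap.toContinuousLinearMap
    (A.toEuclideanLin ∘ₗ firstCoordsLin hl ∘ₗ R⁻¹.toEuclideanLin)
  have hLa : ∀ x, L x = A.toEuclideanLin (firstCoords hl (R⁻¹.toEuclideanLin x)) := fun _ => rfl
  have hL : ∀ a ∈ C, ∀ c ∈ K, L (γ.toEuclideanLin a + c) = a := by
    intro a ha c hc
    obtain ⟨v, rfl⟩ : a ∈ Set.range A.toEuclideanLin := hCA ▸ subset_sub_self C ha
    obtain ⟨w, rfl⟩ := hKB (subset_sub_self K hc)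
    rw [hLa, ← toEuclideanLin_mul_apply γ A, ← blockMatrix_joinCoords hl,
      ← toEuclideanLin_mul_apply, Matrix.nonsing_inv_mul _ hdet, toEuclideanLin_one_apply,
      firstCoords_joinCoords]
  have h := hA.tendstoInDistribution hθ L hL
  have hcont : Continuous fun x => L (coneProj S γ C K x) :=
    L.continuous.comp (continuous_coneProj _ γ C K hC hK)
  have hfun : (fun z : Vec k => A.toEuclideanLin (firstCoords hl
      ((R⁻¹ * CFC.sqrt S).toEuclideanLin (metricProj (scaledCone S γ C K) z)))) =
      (fun x => L (coneProj S γ C K x)) ∘ sqrtCLM S := by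
    funext z
    rw [Function.comp, hLa, coneProj, invSqrtCLM_sqrtCLM hA.posDef, toEuclideanLin_mul_apply]
    rfl
  rw [hfun]
  refine h.of_map_eq (hcont.comp (sqrtCLM S).continuous).aemeasurable ?_
  have hG : multivariateGaussian 0 S = (stdGaussian (Vec k)).map (sqrtCLM S) := by
    rw [multivariateGaussian]
    congr 1
    funext x
    rw [zero_add]
    rfl
  rw [hG, Measure.map_map hcont.measurable (sqrtCLM S).continuous.measurable]

/-- The normal limit law. With `D = γ - B Λ'`, `Λ` the regression coefficient of the scores, the
residual second moment is `V = D' Σ⁻¹ D`, and `L = V⁻¹ D' Σ⁻¹` satisfies `L γ = 1` and `L B = 0`.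
As `G - coneProj G` is `Σ⁻¹`-orthogonal to the columns of `D`, the projection drops out and the
limit is `L G` with `G ∼ N(0, Σ)`, whose covariance is `V⁻¹`. -/
theorem Assumptions.tendstoInDistribution_subspace (hA : Assumptions P Z g μs 𝓜 Θ θ0 Sn γ K C)
    {θhat : ℕ → Ω → Vec d} (hθ : IsApproxMinimizer P Z g 𝓜 Θ Sn θhat)
    {p : ℕ} {B : Matrix (Fin k) (Fin p) ℝ} (hC : (C : Set (Vec d)) = Set.univ)
    (hK : (K : Set (Vec k)) = Set.range B.toEuclideanLin) (hB : B.rank = p) :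
    IsUnit (crossMoment μs (scoreFn g μs B) (scoreFn g μs B)).det ∧
      IsUnit (residualMoment μs (scoreFn g μs γ) (scoreFn g μs B)).det ∧
      TendstoInDistribution (fun (n : ℕ) ω => Real.sqrt n • (θhat n ω - θ0)) atTop id
        (fun _ => P)
        (multivariateGaussian 0
          (residualMoment μs (scoreFn g μs γ) (scoreFn g μs B))⁻¹) := by
  have hcross := fun {p q : ℕ} (D : Matrix (Fin k) (Fin p) ℝ) (E : Matrix (Fin k) (Fin q) ℝ) =>
    crossMoment_scoreFn hA.memLp_g hA.nonsingular D E
  have hS := hA.posDef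
  have hSdet := hA.nonsingular
  have hgram : ∀ {q : ℕ} (D : Matrix (Fin k) (Fin q) ℝ), Function.Injective D.toEuclideanLin →
      (Dᵀ * (momentCov g μs)⁻¹ * D).PosDef := by
    intro q D hD
    have := hS.inv.conjTranspose_mul_mul_same (injective_mulVec_of_toEuclideanLin hD)
    rwa [Matrix.conjTranspose_eq_transpose_of_trivial] at this
  have hBpd := hgram B (injective_toEuclideanLin_of_rank hB)
  have hBu : IsUnit (Bᵀ * (momentCov g μs)⁻¹ * B).det :=
    (Matrix.isUnit_iff_isUnit_det _).1 hBpd.isUnit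
  have hcoef : projCoef μs (scoreFn g μs γ) (scoreFn g μs B) =
      γᵀ * (momentCov g μs)⁻¹ * B * (Bᵀ * (momentCov g μs)⁻¹ * B)⁻¹ := by
    rw [projCoef, hcross, hcross]
  have hres : residualMoment μs (scoreFn g μs γ) (scoreFn g μs B) =
      (γ - B * (projCoef μs (scoreFn g μs γ) (scoreFn g μs B))ᵀ)ᵀ * (momentCov g μs)⁻¹ *
        (γ - B * (projCoef μs (scoreFn g μs γ) (scoreFn g μs B))ᵀ) := by
    rw [residualMoment, residual_scoreFn, hcross]
  set Λ := projCoef μs (scoreFn g μs γ) (scoreFn g μs B)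
  set D := γ - B * Λᵀ with hDdef
  rw [hcross, hres]
  set S := momentCov g μs
  have hDapp : ∀ x, D.toEuclideanLin x =
      γ.toEuclideanLin x - B.toEuclideanLin (Λᵀ.toEuclideanLin x) := by
    intro x
    rw [hDdef, map_sub, LinearMap.sub_apply, toEuclideanLin_mul_apply]
  -- transversality makes the columns of `D` linearly independent
  have hDinj : Function.Injective D.toEuclideanLin := by
    refine (injective_iff_map_eq_zero _).2 fun x hx => ?_
    rw [hDapp, sub_eq_zero] at hx
    have hmem : γ.toEuclideanLin x ∈
        (γ.toEuclideanLin '' ((C : Set (Vec d)) - (C : Set (Vec d)))) ∩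
          ((K : Set (Vec k)) - (K : Set (Vec k))) := by
      refine ⟨⟨x, subset_sub_self C (by rw [hC]; trivial), rfl⟩, subset_sub_self K ?_⟩
      rw [hK, hx]
      exact ⟨_, rfl⟩
    rw [hA.transversal, Set.mem_singleton_iff] at hmem
    exact (map_eq_zero_iff _ (injective_toEuclideanLin_of_rank hA.full_rank)).1 hmem
  have hDpd := hgram D hDinj
  have hDu : IsUnit (Dᵀ * S⁻¹ * D).det := (Matrix.isUnit_iff_isUnit_det _).1 hDpd.isUnit
  refine ⟨hBu, hDu, ?_⟩
  set V := Dᵀ * S⁻¹ * D with hV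
  -- the normal equations
  have hDB : Dᵀ * S⁻¹ * B = 0 := by
    rw [hDdef, Matrix.transpose_sub, Matrix.transpose_mul, Matrix.transpose_transpose,
      Matrix.sub_mul, Matrix.sub_mul, Matrix.mul_assoc Λ, Matrix.mul_assoc Λ, hcoef,
      Matrix.nonsing_inv_mul_cancel_right _ _ hBu, sub_self]
  have hDγ : Dᵀ * S⁻¹ * γ = V := by
    have : γ = D + B * Λᵀ := by rw [hDdef, sub_add_cancel]
    conv_lhs => rw [this]
    rw [Matrix.mul_add, ← Matrix.mul_assoc _ B, hDB, Matrix.zero_mul, add_zero]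
  let L : Vec k →L[ℝ] Vec d := LinearMap.toContinuousLinearMap (V⁻¹ * (Dᵀ * S⁻¹)).toEuclideanLin
  have hLa : ∀ x, L x = (V⁻¹ * (Dᵀ * S⁻¹)).toEuclideanLin x := fun _ => rfl
  have hL : ∀ a ∈ C, ∀ c ∈ K, L (γ.toEuclideanLin a + c) = a := by
    intro a _ c hc
    obtain ⟨w, rfl⟩ : c ∈ Set.range B.toEuclideanLin := hK ▸ hc
    rw [hLa, map_add, ← toEuclideanLin_mul_apply, ← toEuclideanLin_mul_apply, Matrix.mul_assoc,
      Matrix.mul_assoc V⁻¹, hDB, hDγ, Matrix.nonsing_inv_mul _ hDu, Matrix.mul_zero, map_zero,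
      LinearMap.zero_apply, add_zero, toEuclideanLin_one_apply]
  have h := hA.tendstoInDistribution hθ L hL
  -- `L` does not see the projection residual
  have hLproj : (fun x => L (coneProj S γ C K x)) = L := by
    funext G
    rw [eq_comm, ← sub_eq_zero, ← map_sub, hLa, toEuclideanLin_mul_apply]
    have hW : γ.toEuclideanLin '' (C : Set (Vec d)) + (K : Set (Vec k)) =
        ((LinearMap.range γ.toEuclideanLin ⊔ LinearMap.range B.toEuclideanLin :
          Submodule ℝ (Vec k)) : Set (Vec k)) := by
      rw [hC, hK, Set.image_univ, Submodule.coe_sup]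
      rfl
    have h0 : (Dᵀ * S⁻¹).toEuclideanLin (G - coneProj S γ C K G) = 0 := by
      have hz : ∀ y : Vec d, inner ℝ
          ((Dᵀ * S⁻¹).toEuclideanLin (G - coneProj S γ C K G)) y = 0 := by
        intro y
        have hy : D.toEuclideanLin y ∈
            LinearMap.range γ.toEuclideanLin ⊔ LinearMap.range B.toEuclideanLin := by
          rw [hDapp]
          exact Submodule.sub_mem _ (Submodule.mem_sup_left ⟨_, rfl⟩)
            (Submodule.mem_sup_right ⟨_, rfl⟩)
        rw [← dotProduct_sub_coneProj_eq_zero hS _ hW G hy,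
          EuclideanSpace.inner_eq_star_dotProduct, star_trivial]
        have e1 : (D.toEuclideanLin y).ofLp = D *ᵥ y.ofLp := rfl
        have e2 : ((Dᵀ * S⁻¹).toEuclideanLin (G - coneProj S γ C K G)).ofLp =
            (Dᵀ * S⁻¹) *ᵥ (G - coneProj S γ C K G).ofLp := rfl
        rw [e1, e2, ← Matrix.mulVec_mulVec, Matrix.dotProduct_mulVec, Matrix.vecMul_transpose]
      exact inner_self_eq_zero.1 (hz _)
    rw [h0, map_zero]
  rw [hLproj] at h
  refine h.of_map_eq aemeasurable_id ?_
  rw [Measure.map_id, map_multivariateGaussian hS.posSemidef]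
  have hSsymm : Sᵀ = S := by
    have := hS.isHermitian.eq
    rwa [Matrix.conjTranspose_eq_transpose_of_trivial] at this
  have hVsymm : Vᵀ = V := by
    have := hDpd.isHermitian.eq
    rwa [Matrix.conjTranspose_eq_transpose_of_trivial] at this
  -- the covariance matrix is `V⁻¹ D' Σ⁻¹ Σ Σ⁻¹ D V⁻¹ = V⁻¹`
  congr 1
  rw [Matrix.transpose_mul, Matrix.transpose_mul, Matrix.transpose_transpose,
    Matrix.transpose_nonsing_inv, Matrix.transpose_nonsing_inv, hSsymm, hVsymm,
    Matrix.mul_assoc V⁻¹, Matrix.nonsing_inv_mul_cancel_right _ _ hSdet, Matrix.mul_assoc V⁻¹,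
    ← Matrix.mul_assoc Dᵀ, ← Matrix.mul_assoc Dᵀ S⁻¹ D, ← hV, Matrix.mul_nonsing_inv _ hDu,
    Matrix.mul_one]

end PointIdEstimation

open PointIdEstimation in
theorem mainTheorem11 {d k : ℕ} {Ω 𝒵 : Type*} [MeasurableSpace Ω] [MeasurableSpace 𝒵]
    (P : Measure Ω) [IsProbabilityMeasure P] (Z : ℕ → Ω → 𝒵)
    (g : 𝒵 → Vec k) (μs : ProbabilityMeasure 𝒵) (𝓜 : Vec d → Set (ProbabilityMeasure 𝒵))
    (Θ : Set (Vec d)) (θ0 : Vec d) (Sn : ℕ → Ω → Matrix (Fin k) (Fin k) ℝ)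
    (γ : Matrix (Fin k) (Fin d) ℝ) (K : ConvexCone ℝ (Vec k)) (C : ConvexCone ℝ (Vec d))
    (hA : Assumptions P Z g μs 𝓜 Θ θ0 Sn γ K C)
    (θhat : ℕ → Ω → Vec d) (hθ : IsApproxMinimizer P Z g 𝓜 Θ Sn θhat) :
    -- the limit law, a linear image of the projection of a standard normal vector on a cone
    (∀ (l : ℕ) (hl : l ≤ k) (A : Matrix (Fin d) (Fin l) ℝ) (B : Matrix (Fin k) (Fin (k - l)) ℝ),
      A.rank = l →
      (C : Set (Vec d)) - (C : Set (Vec d)) = Set.range A.toEuclideanLin →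
      B.rank = k - l →
      (K : Set (Vec k)) - (K : Set (Vec k)) ⊆ Set.range B.toEuclideanLin →
      Set.range B.toEuclideanLin ∩ Set.range (γ * A).toEuclideanLin = {0} →
      IsUnit (blockMatrix hl (γ * A) B).det ∧
      TendstoInDistribution (fun (n : ℕ) ω => Real.sqrt n • (θhat n ω - θ0)) atTop
        (fun z : Vec k => A.toEuclideanLin (firstCoords hl
          (((blockMatrix hl (γ * A) B)⁻¹ * CFC.sqrt (momentCov g μs)).toEuclideanLin
            (metricProj (scaledCone (momentCov g μs) γ C K) z))))
        (fun _ => P) (stdGaussian (Vec k))) ∧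
    -- the normal limit when `C` is the whole space and `K` is a subspace
    (∀ (p : ℕ) (B : Matrix (Fin k) (Fin p) ℝ),
      (C : Set (Vec d)) = Set.univ →
      (K : Set (Vec k)) = Set.range B.toEuclideanLin →
      B.rank = p →
      IsUnit (crossMoment μs (scoreFn g μs B) (scoreFn g μs B)).det ∧
      IsUnit (residualMoment μs (scoreFn g μs γ) (scoreFn g μs B)).det ∧
      TendstoInDistribution (fun (n : ℕ) ω => Real.sqrt n • (θhat n ω - θ0)) atTop id
        (fun _ => P)
        (multivariateGaussian 0
          (residualMoment μs (scoreFn g μs γ) (scoreFn g μs B))⁻¹)) := by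
  exact ⟨fun l hl A B hAr hCA hBr hKB hBA =>
      hA.tendstoInDistribution_cone hθ hl hAr hCA hBr hKB hBA,
    fun p B hC hK hB => hA.tendstoInDistribution_subspace hθ hC hK hB⟩
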